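/- Let $d_1,d_2\ge 1$ be integers and $d=d_1+d_2$; write $x=(x_1,x_2)$ for $x\in\mathbb{R}^d$ with $x_1\in\mathbb{R}^{d_1}$, $x_2\in\mathbb{R}^{d_2}$. Let $g(t,x,y)=(4\pi t)^{-d/2}e^{-|y-x|^2/(4t)}$, $t>0$, $x,y\in\mathbb{R}^d$, be the Gauss–Weierstrass kernel. For a Borel measurable $V\colon\mathbb{R}^d\to\mathbb{R}$ let $G=\sum_{n\ge 0}p_n$ be the Schrödinger perturbation of $g$ by $V$, given by the perturbation series $p_0=g$, $$p_{n+1}(t,x,y)=\int_0^t\int_{\mathbb{R}^d}p_n(s,x,z)V(z)g(t-s,z,y)\,dz\,ds .$$ We call $G$ well defined if, for all $t>0$ and $x,y\in\mathbb{R}^d$, these integrals and this series converge absolutely and Duhamel's formula $$G(t,x,y)=g(t,x,y)+\int_0^t\int_{\mathbb{R}^d}G(s,x,z)V(z)g(t-s,z,y)\,dz\,ds$$ holds with an absolutely convergent integral. Let $p_1,p_2\in[1,\infty]$ satisfy $\frac{d_1}{2p_1}+\frac{d_2}{2p_2}=1$ (with $1/\infty=0$). (a) If $r\in(p_1,\infty]$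 and $V(x_1,x_2)=V_1(x_1)V_2(x_2)$ for all $x_1,x_2$, with some $V_1\in L^r(\mathbb{R}^{d_1})$ and $V_2\in L^{p_2}(\mathbb{R}^{d_2})$, then $G$ is well defined, and for every $T\in(0,\infty)$ there are constants $0<c_1\le c_2<\infty$ such that $$c_1\le\frac{G(t,x,y)}{g(t,x,y)}\le c_2,\qquad 0<t\le T,\ x,y\in\mathbb{R}^d .$$ (b) If $1\le q<p_1<r\le\infty$, $V\le 0$, and $V(x_1,x_2)=V_1(x_1)V_2(x_2)$ for all $x_1,x_2$, with some $V_1\in L^q(\mathbb{R}^{d_1})\cap L^r(\mathbb{R}^{d_1})$ and $V_2\in L^{p_2}(\mathbb{R}^{d_2})$, then $G$ is well defined, and there are constants $0<c_1\le c_2<\infty$ such that $$c_1\le\frac{G(t,x,y)}{g(t,x,y)}\le c_2,\qquad t>0,\ x,y\in\mathbb{R}^d .$$ -/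

import Mathlib

open MeasureTheory Set
open scoped ENNReal

noncomputable section

namespace GaussianBounds

/-- The Euclidean space `ℝ^d`. -/
abbrev Rd (d : ℕ) : Type := EuclideanSpace ℝ (Fin d)

/-- The Gauss–Weierstrass kernel `g(t,x,y) = (4πt)^{-d/2} exp(-|y-x|²/(4t))` (used for `t > 0`). -/
def gaussKernel {d : ℕ} (t : ℝ) (x y : Rd d) : ℝ :=
  (4 * Real.pi * t) ^ (-(d : ℝ) / 2) * Real.exp (-‖y - x‖ ^ 2 / (4 * t))

/-- The terms of the perturbation series: `p₀ = g` and
`pₙ₊₁(t,x,y) = ∫₀ᵗ ∫ pₙ(s,x,z) V(z) g(t-s,z,y) dz ds`. -/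
def perturbTerm {d : ℕ} (V : Rd d → ℝ) : ℕ → ℝ → Rd d → Rd d → ℝ
  | 0 => fun t x y => gaussKernel t x y
  | n + 1 => fun t x y =>
      ∫ s in Ioo 0 t, ∫ z, perturbTerm V n s x z * V z * gaussKernel (t - s) z y

/-- The Schrödinger perturbation `G` of `g` by `V`, as the sum of the perturbation series. -/
def schrodingerKernel {d : ℕ} (V : Rd d → ℝ) (t : ℝ) (x y : Rd d) : ℝ :=
  ∑' n, perturbTerm V n t x y

/-- The Schrödinger perturbation of `g` by `V` is well defined and solves Duhamel's formula: all
space-time integrals in the perturbation series converge absolutely, the series converges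
absolutely, and
`G(t,x,y) = g(t,x,y) + ∫₀ᵗ ∫ G(s,x,z) V(z) g(t-s,z,y) dz ds` with an absolutely convergent
integral. -/
structure PerturbationWellDefined {d : ℕ} (V : Rd d → ℝ) : Prop where
  term_integrable : ∀ (n : ℕ) (t : ℝ) (x y : Rd d), 0 < t →
    IntegrableOn
      (fun w : ℝ × Rd d => perturbTerm V n w.1 x w.2 * V w.2 * gaussKernel (t - w.1) w.2 y)
      (Ioo 0 t ×ˢ univ) volume
  series_summable : ∀ (t : ℝ) (x y : Rd d), 0 < t → Summable fun n => perturbTerm V n t x y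
  duhamel_integrable : ∀ (t : ℝ) (x y : Rd d), 0 < t →
    IntegrableOn
      (fun w : ℝ × Rd d => schrodingerKernel V w.1 x w.2 * V w.2 * gaussKernel (t - w.1) w.2 y)
      (Ioo 0 t ×ˢ univ) volume
  duhamel : ∀ (t : ℝ) (x y : Rd d), 0 < t →
    schrodingerKernel V t x y = gaussKernel t x y +
      ∫ s in Ioo 0 t, ∫ z, schrodingerKernel V s x z * V z * gaussKernel (t - s) z y

/-- Sharp Gaussian estimates for the kernel `G`, local in time (up to time `T`). -/
def SharpLocalBounds {d : ℕ} (G : ℝ → Rd d → Rd d → ℝ) (T : ℝ) : Prop :=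
  ∃ c₁ c₂ : ℝ, 0 < c₁ ∧ c₁ ≤ c₂ ∧ ∀ (t : ℝ) (x y : Rd d), 0 < t → t ≤ T →
    c₁ ≤ G t x y / gaussKernel t x y ∧ G t x y / gaussKernel t x y ≤ c₂

/-- Sharp Gaussian estimates for the kernel `G`, global in time. -/
def SharpGlobalBounds {d : ℕ} (G : ℝ → Rd d → Rd d → ℝ) : Prop :=
  ∃ c₁ c₂ : ℝ, 0 < c₁ ∧ c₁ ≤ c₂ ∧ ∀ (t : ℝ) (x y : Rd d), 0 < t →
    c₁ ≤ G t x y / gaussKernel t x y ∧ G t x y / gaussKernel t x y ≤ c₂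

/-- The first `d₁` coordinates of a point of `ℝ^{d₁+d₂}`. -/
def fstPart {d₁ d₂ : ℕ} (x : Rd (d₁ + d₂)) : Rd d₁ :=
  WithLp.toLp 2 fun i => x (Fin.castAdd d₂ i)

/-- The last `d₂` coordinates of a point of `ℝ^{d₁+d₂}`. -/
def sndPart {d₁ d₂ : ℕ} (x : Rd (d₁ + d₂)) : Rd d₂ :=
  WithLp.toLp 2 fun i => x (Fin.natAdd d₁ i)

/-- The functions on `ℝ^d` that belong to `L^p` for Lebesgue measure. -/
def LpFun (d : ℕ) (p : ℝ≥0∞) : Set (Rd d → ℝ) :=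
  {f | MemLp f p volume}

/-- `A × B`: the functions `f(x₁,x₂) = f₁(x₁) f₂(x₂)` with `f₁ ∈ A` and `f₂ ∈ B`. -/
def tensorClass {d₁ d₂ : ℕ} (A : Set (Rd d₁ → ℝ)) (B : Set (Rd d₂ → ℝ)) :
    Set (Rd (d₁ + d₂) → ℝ) :=
  {f | ∃ f₁ ∈ A, ∃ f₂ ∈ B, ∀ x, f x = f₁ (fstPart x) * f₂ (sndPart x)}

end GaussianBounds

end

noncomputable section

namespace GaussianBounds

open Filter Topology

/-! Everything rests on one estimate, `BridgeBound`. The product g(s,x,z)g(r,z,y) equals g(s+r,x,y)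
times a Gaussian density in z of time parameter sr/(s+r). Integrating |V| = |V₁||V₂| against that
density factors over the two coordinate blocks, and Hölder in each block gives C(s^{-a} + r^{-a})
with a = d₁/(2p) + d₂/(2p₂) when V₁ ∈ L^p. At p = p₁ this exponent is exactly 1, so p = r > p₁ gives
a < 1 and p = q < p₁ gives an exponent b > 1.

If a < 1, the time singularities are integrable and induction yields |pₙ| ≤ cₙ t^{n(1-a)} g with
cₙ₊₁/cₙ → 0. Hence the series converges, Duhamel's formula holds and |G| ≤ const · g locally in
time. For small t the tail is at most g/2, so G ≥ g/2; the Chapman–Kolmogorov equations for G then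
carry a lower bound from time t to time 2t, hence to any finite horizon.

If moreover V ≤ 0, positivity of G in Duhamel's formula gives G ≤ g, and substituting this back
gives G ≥ g + p₁. The latter is useless for large t near the ends of (0,t), where s^{-b} is not
integrable. So G is composed over three time intervals A, t', A: the bound G ≥ cg is used on the
outer two and G ≥ g + p₁ in the middle (`IsSubcritical.mul_middleTerm_le`). Only interaction times
at distance at least A from both ends remain, and since b > 1 their contribution is O(A^{1-b}) g
uniformly in t'. For A large it is at most g/2. -/

/-! ### The Gaussian kernel, its bridge factorization and its action on L^p. -/

lemma gaussKernel_pos {d : ℕ} {t : ℝ} (ht : 0 < t) (x y : Rd d) : 0 < gaussKernel t x y := by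
  unfold gaussKernel; positivity

lemma measurable_gaussKernel {d : ℕ} :
    Measurable fun w : ℝ × Rd d × Rd d => gaussKernel w.1 w.2.1 w.2.2 := by
  unfold gaussKernel; fun_prop

lemma gaussKernel_le {d : ℕ} {t : ℝ} (ht : 0 < t) (x y : Rd d) :
    gaussKernel t x y ≤ (4 * Real.pi * t) ^ (-(d : ℝ) / 2) := by
  unfold gaussKernel
  refine mul_le_of_le_one_right (by positivity) (Real.exp_le_one_iff.2 ?_)
  rw [neg_div]; exact neg_nonpos.2 (by positivity)

/-- The product of two Gaussian kernels factors through the Brownian bridge density. -/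
lemma gaussKernel_mul_gaussKernel {d : ℕ} {s r : ℝ} (hs : 0 < s) (hr : 0 < r) (x y z : Rd d) :
    gaussKernel s x z * gaussKernel r z y =
      gaussKernel (s + r) x y *
        gaussKernel (s * r / (s + r)) (x + (s / (s + r)) • (y - x)) z := by
  have hsr : 0 < s + r := by positivity
  unfold gaussKernel
  have h1 : (4 * Real.pi * s) ^ (-(d : ℝ) / 2) * (4 * Real.pi * r) ^ (-(d : ℝ) / 2) =
      (4 * Real.pi * (s + r)) ^ (-(d : ℝ) / 2) *
        (4 * Real.pi * (s * r / (s + r))) ^ (-(d : ℝ) / 2) := by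
    rw [← Real.mul_rpow (by positivity) (by positivity),
      ← Real.mul_rpow (by positivity) (by positivity)]
    congr 1; field_simp
  -- Completing the square in z: the centre is the point of the segment from x to y reached at
  -- fraction s/(s+r).
  have h2 : -‖z - x‖ ^ 2 / (4 * s) + -‖y - z‖ ^ 2 / (4 * r) = -‖y - x‖ ^ 2 / (4 * (s + r)) +
      -‖z - (x + (s / (s + r)) • (y - x))‖ ^ 2 / (4 * (s * r / (s + r))) := by
    have e1 : y - x = (z - x) + (y - z) := by abel
    have e2 : z - (x + (s / (s + r)) • (y - x)) =
        (r / (s + r)) • (z - x) - (s / (s + r)) • (y - z) := by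
      have : r / (s + r) = 1 - s / (s + r) := by field_simp; ring
      rw [this]; module
    rw [e2, e1]
    generalize z - x = a
    generalize y - z = b
    rw [norm_add_sq_real, norm_sub_sq_real, norm_smul, norm_smul, real_inner_smul_left,
      real_inner_smul_right, mul_pow, mul_pow, Real.norm_eq_abs, Real.norm_eq_abs, sq_abs, sq_abs]
    field_simp; ring
  calc _ = ((4 * Real.pi * s) ^ (-(d : ℝ) / 2) * (4 * Real.pi * r) ^ (-(d : ℝ) / 2)) *
        Real.exp (-‖z - x‖ ^ 2 / (4 * s) + -‖y - z‖ ^ 2 / (4 * r)) := by rw [Real.exp_add]; ring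
    _ = _ := by rw [h1, h2, Real.exp_add]; ring

lemma integral_gaussKernel {d : ℕ} {t : ℝ} (ht : 0 < t) (x : Rd d) :
    ∫ z, gaussKernel t x z = 1 := by
  unfold gaussKernel
  rw [integral_const_mul,
    integral_sub_right_eq_self (fun z : Rd d => Real.exp (-‖z‖ ^ 2 / (4 * t))) x]
  have := GaussianFourier.integral_rexp_neg_mul_sq_norm (V := Rd d) (b := 1 / (4 * t))
    (by positivity)
  have e : (fun z : Rd d => Real.exp (-‖z‖ ^ 2 / (4 * t))) =
      fun v => Real.exp (-(1 / (4 * t)) * ‖v‖ ^ 2) := by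
    ext z; congr 1; ring
  rw [e, this, finrank_euclideanSpace_fin,
    show Real.pi / (1 / (4 * t)) = 4 * Real.pi * t by field_simp,
    ← Real.rpow_add (by positivity)]
  rw [show -(d : ℝ) / 2 + (d : ℝ) / 2 = 0 by ring, Real.rpow_zero]

lemma integrable_gaussKernel {d : ℕ} {t : ℝ} (ht : 0 < t) (x : Rd d) :
    Integrable fun z => gaussKernel t x z := by
  by_contra h
  have := integral_gaussKernel ht x
  rw [integral_undef h] at this
  exact zero_ne_one this

lemma integrable_gaussKernel_mul {d : ℕ} {s r : ℝ} (hs : 0 < s) (hr : 0 < r) (x y : Rd d) :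
    Integrable fun z => gaussKernel s x z * gaussKernel r z y := by
  simp_rw [gaussKernel_mul_gaussKernel hs hr]
  exact (integrable_gaussKernel (by positivity) _).const_mul _

/-- The Chapman–Kolmogorov equation for the Gaussian kernel. -/
lemma integral_gaussKernel_mul {d : ℕ} {s r : ℝ} (hs : 0 < s) (hr : 0 < r) (x y : Rd d) :
    ∫ z, gaussKernel s x z * gaussKernel r z y = gaussKernel (s + r) x y := by
  simp_rw [gaussKernel_mul_gaussKernel hs hr]
  rw [integral_const_mul, integral_gaussKernel (by positivity), mul_one]

lemma lintegral_gaussKernel {d : ℕ} {t : ℝ} (ht : 0 < t) (x : Rd d) :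
    ∫⁻ z, ENNReal.ofReal (gaussKernel t x z) = 1 := by
  rw [← ofReal_integral_eq_lintegral_ofReal (integrable_gaussKernel ht x)
    (.of_forall fun z => (gaussKernel_pos ht x z).le), integral_gaussKernel ht x,
    ENNReal.ofReal_one]

/-- Convolution with the Gaussian kernel maps `L^p` to bounded functions. -/
lemma lintegral_gaussKernel_mul_enorm_le {d : ℕ} {t : ℝ} (ht : 0 < t) (x : Rd d) {p : ℝ≥0∞}
    (hp : 1 ≤ p) {f : Rd d → ℝ} (hf : AEStronglyMeasurable f volume) :
    ∫⁻ z, ENNReal.ofReal (gaussKernel t x z) * ‖f z‖ₑ ≤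
      ENNReal.ofReal ((4 * Real.pi * t) ^ (-((d : ℝ) / 2 * (1 / p).toReal))) *
        eLpNorm f p volume := by
  set M : ℝ := (4 * Real.pi * t) ^ (-(d : ℝ) / 2) with hM
  have hM0 : 0 < M := by positivity
  have hgm : Measurable fun z => ENNReal.ofReal (gaussKernel t x z) :=
    (measurable_gaussKernel.comp
      (measurable_const.prodMk (measurable_const.prodMk measurable_id))).ennreal_ofReal
  -- As a probability measure, μ satisfies ‖f‖_{L¹(μ)} ≤ ‖f‖_{L^p(μ)}; the domination μ ≤ M · volume
  -- then costs only M^{1/p}. This covers p = ∞ without a case split.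
  set μ : Measure (Rd d) := volume.withDensity fun z => ENNReal.ofReal (gaussKernel t x z)
  have hμ : IsProbabilityMeasure μ := ⟨by
    rw [withDensity_apply _ MeasurableSet.univ, setLIntegral_univ, lintegral_gaussKernel ht x]⟩
  have hle : μ ≤ ENNReal.ofReal M • (volume : Measure (Rd d)) := by
    rw [← withDensity_const]
    exact withDensity_mono (.of_forall fun z => ENNReal.ofReal_le_ofReal (gaussKernel_le ht x z))
  have hfμ : AEStronglyMeasurable f μ := hf.mono_ac (withDensity_absolutelyContinuous _ _)
  calc ∫⁻ z, ENNReal.ofReal (gaussKernel t x z) * ‖f z‖ₑ = ∫⁻ z, ‖f z‖ₑ ∂μ := by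
        rw [lintegral_withDensity_eq_lintegral_mul₀ hgm.aemeasurable hf.enorm]; rfl
    _ = eLpNorm f 1 μ := eLpNorm_one_eq_lintegral_enorm.symm
    _ ≤ eLpNorm f p μ := eLpNorm_le_eLpNorm_of_exponent_le hp hfμ
    _ ≤ eLpNorm f p (ENNReal.ofReal M • volume) := eLpNorm_mono_measure _ hle
    _ = ENNReal.ofReal M ^ (1 / p).toReal * eLpNorm f p volume := by
        rw [eLpNorm_smul_measure_of_ne_zero (by simpa using hM0), smul_eq_mul]
    _ = _ := by
        rw [ENNReal.ofReal_rpow_of_pos hM0, hM, ← Real.rpow_mul (by positivity)]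
        congr 3; ring

/-! ### Product structure of the space and bridge bounds for tensor products. -/

lemma norm_sq_eq_fstPart_add_sndPart {d₁ d₂ : ℕ} (x : Rd (d₁ + d₂)) :
    ‖x‖ ^ 2 = ‖fstPart x‖ ^ 2 + ‖sndPart x‖ ^ 2 := by
  simp [EuclideanSpace.norm_sq_eq, Fin.sum_univ_add, fstPart, sndPart]

/-- The splitting `ℝ^{d₁+d₂} = ℝ^{d₁} × ℝ^{d₂}` as a linear isometry. -/
def splitIsometry (d₁ d₂ : ℕ) : Rd (d₁ + d₂) ≃ₗᵢ[ℝ] WithLp 2 (Rd d₁ × Rd d₂) where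
  toFun x := WithLp.toLp 2 (fstPart x, sndPart x)
  invFun w := WithLp.toLp 2 (Fin.append w.fst w.snd)
  map_add' x y := rfl
  map_smul' c x := rfl
  left_inv x := by
    ext i
    refine Fin.addCases (fun j => ?_) (fun j => ?_) i <;> simp [fstPart, sndPart]
  right_inv w := by
    apply WithLp.ofLp_injective
    refine Prod.ext ?_ ?_ <;> ext j <;> simp [fstPart, sndPart]
  norm_map' x := by
    rw [← sq_eq_sq₀ (norm_nonneg _) (norm_nonneg _), WithLp.prod_norm_sq_eq_of_L2]
    exact (norm_sq_eq_fstPart_add_sndPart x).symm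

lemma measurePreserving_fstPart_sndPart (d₁ d₂ : ℕ) :
    MeasurePreserving fun x : Rd (d₁ + d₂) => (fstPart x, sndPart x) :=
  (WithLp.volume_preserving_ofLp (Rd d₁) (Rd d₂)).comp (splitIsometry d₁ d₂).measurePreserving

lemma gaussKernel_eq_mul {d₁ d₂ : ℕ} {t : ℝ} (ht : 0 < t) (x z : Rd (d₁ + d₂)) :
    gaussKernel t x z =
      gaussKernel t (fstPart x) (fstPart z) * gaussKernel t (sndPart x) (sndPart z) := by
  unfold gaussKernel
  have h1 : fstPart z - fstPart x = fstPart (z - x) := rfl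
  have h2 : sndPart z - sndPart x = sndPart (z - x) := rfl
  rw [h1, h2, norm_sq_eq_fstPart_add_sndPart,
    show -((d₁ + d₂ : ℕ) : ℝ) / 2 = -(d₁ : ℝ) / 2 + -(d₂ : ℝ) / 2 by push_cast; ring,
    Real.rpow_add (by positivity), neg_add, add_div, Real.exp_add]
  ring

/-- Integration of `|V|` against a Brownian bridge from `x` to `y` of length `s + r` at time `s` is
bounded by `C (s^{-a} + r^{-a})`, uniformly in `x` and `y`. -/
def BridgeBound {d : ℕ} (V : Rd d → ℝ) (C a : ℝ) : Prop :=
  ∀ ⦃s r : ℝ⦄, 0 < s → 0 < r → ∀ x y : Rd d,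
    ∫⁻ z, ENNReal.ofReal (gaussKernel s x z) * ‖V z‖ₑ * ENNReal.ofReal (gaussKernel r z y) ≤
      ENNReal.ofReal (C * (s ^ (-a) + r ^ (-a))) * ENNReal.ofReal (gaussKernel (s + r) x y)

lemma lintegral_gaussKernel_mul_tensor_le {d₁ d₂ : ℕ} {t : ℝ} (ht : 0 < t) (x : Rd (d₁ + d₂))
    {p₁ p₂ : ℝ≥0∞} (hp₁ : 1 ≤ p₁) (hp₂ : 1 ≤ p₂) {f₁ : Rd d₁ → ℝ} {f₂ : Rd d₂ → ℝ}
    (hf₁ : AEStronglyMeasurable f₁ volume) (hf₂ : AEStronglyMeasurable f₂ volume) :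
    ∫⁻ z, ENNReal.ofReal (gaussKernel t x z) * ‖f₁ (fstPart z) * f₂ (sndPart z)‖ₑ ≤
      ENNReal.ofReal ((4 * Real.pi * t) ^
        (-((d₁ : ℝ) / 2 * (1 / p₁).toReal + (d₂ : ℝ) / 2 * (1 / p₂).toReal))) *
        (eLpNorm f₁ p₁ volume * eLpNorm f₂ p₂ volume) := by
  have hg {d : ℕ} (m : Rd d) : Measurable fun z => ENNReal.ofReal (gaussKernel t m z) :=
    (measurable_gaussKernel.comp
      (measurable_const.prodMk (measurable_const.prodMk measurable_id))).ennreal_ofReal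
  have h₁ := (hg (fstPart x)).aemeasurable.mul hf₁.enorm
  have h₂ := (hg (sndPart x)).aemeasurable.mul hf₂.enorm
  have hmp := measurePreserving_fstPart_sndPart d₁ d₂
  let F : Rd d₁ × Rd d₂ → ℝ≥0∞ := fun w =>
    (ENNReal.ofReal (gaussKernel t (fstPart x) w.1) * ‖f₁ w.1‖ₑ) *
      (ENNReal.ofReal (gaussKernel t (sndPart x) w.2) * ‖f₂ w.2‖ₑ)
  have hF : AEMeasurable F (volume.prod volume) := h₁.comp_fst.mul h₂.comp_snd
  calc _ = ∫⁻ z, F (fstPart z, sndPart z) := by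
        refine lintegral_congr fun z => ?_
        rw [gaussKernel_eq_mul ht, ENNReal.ofReal_mul (gaussKernel_pos ht _ _).le, enorm_mul]
        simp only [F]; ring
    _ = ∫⁻ w, F w ∂(volume.prod volume) := by
        change _ = ∫⁻ w, F w
        rw [← hmp.map_eq, lintegral_map' (by rw [hmp.map_eq]; exact hF) hmp.aemeasurable]
    _ = (∫⁻ z, ENNReal.ofReal (gaussKernel t (fstPart x) z) * ‖f₁ z‖ₑ) *
          ∫⁻ z, ENNReal.ofReal (gaussKernel t (sndPart x) z) * ‖f₂ z‖ₑ :=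
        lintegral_prod_mul h₁ h₂
    _ ≤ _ := mul_le_mul' (lintegral_gaussKernel_mul_enorm_le ht _ hp₁ hf₁)
        (lintegral_gaussKernel_mul_enorm_le ht _ hp₂ hf₂)
    _ = _ := by
        rw [neg_add, Real.rpow_add (by positivity), ENNReal.ofReal_mul (by positivity)]
        ring

/-- Since sr/(s+r) ≥ min(s,r)/2, the singularity of the bridge variance separates into one
singularity at each end of the time interval. -/
lemma rpow_neg_harmonic_le {s r a : ℝ} (hs : 0 < s) (hr : 0 < r) (ha : 0 ≤ a) :
    (s * r / (s + r)) ^ (-a) ≤ 2 ^ a * (s ^ (-a) + r ^ (-a)) := by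
  have key {u v : ℝ} (hu : 0 < u) (hv : 0 < v) (huv : u ≤ v) :
      (u * v / (u + v)) ^ (-a) ≤ 2 ^ a * u ^ (-a) := by
    have h : u / 2 ≤ u * v / (u + v) := by
      rw [div_le_div_iff₀ (by positivity) (by positivity)]
      nlinarith
    calc (u * v / (u + v)) ^ (-a) ≤ (u / 2) ^ (-a) :=
          Real.rpow_le_rpow_of_nonpos (by positivity) h (by linarith)
      _ = 2 ^ a * u ^ (-a) := by
          rw [Real.div_rpow hu.le zero_le_two, Real.rpow_neg zero_le_two, div_inv_eq_mul, mul_comm]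
  rcases le_total s r with h | h
  · refine (key hs hr h).trans ?_
    gcongr
    exact le_add_of_nonneg_right (by positivity)
  · rw [mul_comm s r, add_comm s r]
    refine (key hr hs h).trans ?_
    gcongr
    exact le_add_of_nonneg_left (by positivity)

/-- Tensor products of `L^p` functions satisfy bridge bounds. -/
lemma exists_bridgeBound_of_tensor {d₁ d₂ : ℕ} {V : Rd (d₁ + d₂) → ℝ} {p₁ p₂ : ℝ≥0∞}
    (hp₁ : 1 ≤ p₁) (hp₂ : 1 ≤ p₂) {f₁ : Rd d₁ → ℝ} {f₂ : Rd d₂ → ℝ}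
    (hf₁ : MemLp f₁ p₁ volume) (hf₂ : MemLp f₂ p₂ volume)
    (hV : ∀ x, V x = f₁ (fstPart x) * f₂ (sndPart x)) :
    ∃ C, 0 < C ∧
      BridgeBound V C ((d₁ : ℝ) / 2 * (1 / p₁).toReal + (d₂ : ℝ) / 2 * (1 / p₂).toReal) := by
  set a : ℝ := (d₁ : ℝ) / 2 * (1 / p₁).toReal + (d₂ : ℝ) / 2 * (1 / p₂).toReal with ha
  set N : ℝ≥0∞ := eLpNorm f₁ p₁ volume * eLpNorm f₂ p₂ volume with hN
  have hNt : N ≠ ∞ := ENNReal.mul_ne_top hf₁.2.ne hf₂.2.ne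
  have ha0 : 0 ≤ a := by positivity
  -- The `+ 1` keeps the constant positive when V vanishes almost everywhere; `2 ^ a` comes from
  -- `rpow_neg_harmonic_le`.
  refine ⟨(4 * Real.pi) ^ (-a) * (N.toReal + 1) * 2 ^ a, by positivity, fun s r hs hr x y => ?_⟩
  have hτ : 0 < s * r / (s + r) := by positivity
  have hg0 : 0 ≤ gaussKernel (s + r) x y := (gaussKernel_pos (by positivity) _ _).le
  calc _ = ∫⁻ z, ENNReal.ofReal (gaussKernel (s + r) x y) *
        (ENNReal.ofReal (gaussKernel (s * r / (s + r)) (x + (s / (s + r)) • (y - x)) z) *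
          ‖f₁ (fstPart z) * f₂ (sndPart z)‖ₑ) := by
        refine lintegral_congr fun z => ?_
        rw [mul_right_comm, ← ENNReal.ofReal_mul (gaussKernel_pos hs _ _).le,
          gaussKernel_mul_gaussKernel hs hr, ENNReal.ofReal_mul hg0, hV, mul_assoc]
    _ = ENNReal.ofReal (gaussKernel (s + r) x y) *
        ∫⁻ z, ENNReal.ofReal (gaussKernel (s * r / (s + r)) (x + (s / (s + r)) • (y - x)) z) *
          ‖f₁ (fstPart z) * f₂ (sndPart z)‖ₑ := lintegral_const_mul' _ _ ENNReal.ofReal_ne_top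
    _ ≤ ENNReal.ofReal (gaussKernel (s + r) x y) *
        (ENNReal.ofReal ((4 * Real.pi * (s * r / (s + r))) ^ (-a)) * N) := by
        gcongr
        exact lintegral_gaussKernel_mul_tensor_le hτ _ hp₁ hp₂ hf₁.1 hf₂.1
    _ ≤ _ := by
        rw [mul_comm]
        gcongr
        rw [← ENNReal.ofReal_toReal hNt, ← ENNReal.ofReal_mul (by positivity),
          Real.mul_rpow (by positivity) hτ.le]
        apply ENNReal.ofReal_le_ofReal
        rw [ENNReal.toReal_ofReal ENNReal.toReal_nonneg, mul_right_comm, mul_assoc _ (2 ^ a)]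
        gcongr
        · linarith
        · exact rpow_neg_harmonic_le hs hr ha0

/-! ### Time integrals and the summable majorant. -/

lemma intervalIntegrable_rpow_neg_add {a : ℝ} (ha1 : a < 1) (t : ℝ) :
    IntervalIntegrable (fun s => s ^ (-a) + (t - s) ^ (-a)) volume 0 t := by
  have h : IntervalIntegrable (fun s : ℝ => s ^ (-a)) volume 0 t :=
    intervalIntegral.intervalIntegrable_rpow' (by linarith)
  refine h.add ?_
  simpa using (h.comp_sub_left t).symm

/-- The moments `∫₀¹ u^{n(1-a)} (u^{-a} + (1-u)^{-a}) du` of the time singularity. -/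
def timeMoment (a : ℝ) (n : ℕ) : ℝ :=
  ∫ u in (0 : ℝ)..1, u ^ (n * (1 - a)) * (u ^ (-a) + (1 - u) ^ (-a))

lemma timeMoment_nonneg (a : ℝ) (n : ℕ) : 0 ≤ timeMoment a n := by
  refine intervalIntegral.integral_nonneg zero_le_one fun u hu => ?_
  have := hu.1; have := sub_nonneg.2 hu.2
  positivity

lemma intervalIntegrable_rpow_mul_rpow_neg_add {a : ℝ} (ha1 : a < 1) (n : ℕ) (t : ℝ) :
    IntervalIntegrable (fun s => s ^ (n * (1 - a)) * (s ^ (-a) + (t - s) ^ (-a))) volume 0 t :=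
  (intervalIntegrable_rpow_neg_add ha1 t).continuousOn_mul
    (Real.continuous_rpow_const (mul_nonneg n.cast_nonneg (by linarith))).continuousOn

/-- Scaling s = ut: the integrand is homogeneous of degree n(1-a) - a, and ds supplies the missing
power of t. -/
lemma integral_rpow_mul_rpow_neg_add {a : ℝ} (n : ℕ) {t : ℝ} (ht : 0 < t) :
    ∫ s in (0 : ℝ)..t, s ^ (n * (1 - a)) * (s ^ (-a) + (t - s) ^ (-a)) =
      timeMoment a n * t ^ ((n + 1 : ℕ) * (1 - a)) := by
  have h := intervalIntegral.mul_integral_comp_mul_right (a := 0) (b := 1)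
    (f := fun s => s ^ (n * (1 - a)) * (s ^ (-a) + (t - s) ^ (-a))) (c := t)
  rw [zero_mul, one_mul] at h
  rw [← h, timeMoment, ← intervalIntegral.integral_const_mul,
    ← intervalIntegral.integral_mul_const]
  refine intervalIntegral.integral_congr fun u hu => ?_
  rw [uIcc_of_le zero_le_one] at hu
  have h0 := hu.1
  have h1 := sub_nonneg.2 hu.2
  rw [show t - u * t = (1 - u) * t by ring, Real.mul_rpow h0 ht.le, Real.mul_rpow h0 ht.le,
    Real.mul_rpow h1 ht.le, show ((n + 1 : ℕ) : ℝ) * (1 - a) = n * (1 - a) + (1 + -a) by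
      push_cast; ring, Real.rpow_add ht, Real.rpow_add ht, Real.rpow_one]
  ring

/-- Dominated convergence, since u^{n(1-a)} → 0 for u < 1. This is all that the ratio test for the
majorant needs, so no Beta function asymptotics enter. -/
lemma tendsto_timeMoment {a : ℝ} (ha1 : a < 1) : Tendsto (timeMoment a) atTop (𝓝 0) := by
  have : Tendsto (timeMoment a) atTop (𝓝 (∫ _ in (0 : ℝ)..1, (0 : ℝ))) := by
    refine intervalIntegral.tendsto_integral_filter_of_dominated_convergence
      (fun u => u ^ (-a) + (1 - u) ^ (-a)) (.of_forall fun n => ?_) (.of_forall fun n => ?_)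
      (intervalIntegrable_rpow_neg_add ha1 1) ?_
    · exact Measurable.aestronglyMeasurable (by fun_prop)
    · refine .of_forall fun u hu => ?_
      rw [uIoc_of_le zero_le_one] at hu
      have h0 := hu.1
      have h1 := sub_nonneg.2 hu.2
      rw [Real.norm_of_nonneg (by positivity)]
      exact mul_le_of_le_one_left (by positivity)
        (Real.rpow_le_one h0.le hu.2 (mul_nonneg n.cast_nonneg (by linarith)))
    · have hne : ∀ᵐ u : ℝ, u ≠ 1 := by simp [ae_iff]
      filter_upwards [hne] with u hu1 hu
      rw [uIoc_of_le zero_le_one] at hu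
      have h0 := hu.1
      have hlt : u ^ (1 - a) < 1 :=
        Real.rpow_lt_one h0.le (lt_of_le_of_ne hu.2 hu1) (by linarith)
      have := (tendsto_pow_atTop_nhds_zero_of_lt_one (by positivity) hlt).mul_const
        (u ^ (-a) + (1 - u) ^ (-a))
      rw [zero_mul] at this
      refine this.congr fun n => ?_
      rw [← Real.rpow_natCast, ← Real.rpow_mul h0.le, mul_comm (1 - a)]
  simpa using this

/-- The constants in the bounds for the terms of the perturbation series. -/
def seriesCoeff (C a : ℝ) : ℕ → ℝ
  | 0 => 1
  | n + 1 => seriesCoeff C a n * (C * timeMoment a n)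

lemma seriesCoeff_nonneg {C a : ℝ} (hC : 0 ≤ C) (n : ℕ) : 0 ≤ seriesCoeff C a n := by
  induction n with
  | zero => exact zero_le_one
  | succ n ih => exact mul_nonneg ih (mul_nonneg hC (timeMoment_nonneg a n))

/-- The relative bound for the `n`-th term of the perturbation series. -/
def termBound (C a : ℝ) (n : ℕ) (t : ℝ) : ℝ := seriesCoeff C a n * t ^ (n * (1 - a))

lemma termBound_nonneg {C a : ℝ} (hC : 0 ≤ C) (n : ℕ) {t : ℝ} (ht : 0 ≤ t) :
    0 ≤ termBound C a n t :=
  mul_nonneg (seriesCoeff_nonneg hC n) (by positivity)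

@[simp] lemma termBound_zero (C a t : ℝ) : termBound C a 0 t = 1 := by
  simp [termBound, seriesCoeff]

lemma termBound_mono {C a : ℝ} (hC : 0 ≤ C) (ha1 : a < 1) (n : ℕ) {s t : ℝ} (hs : 0 ≤ s)
    (hst : s ≤ t) : termBound C a n s ≤ termBound C a n t :=
  mul_le_mul_of_nonneg_left
    (Real.rpow_le_rpow hs hst (mul_nonneg n.cast_nonneg (by linarith))) (seriesCoeff_nonneg hC n)

lemma summable_termBound {C a : ℝ} (hC : 0 ≤ C) (ha1 : a < 1) {t : ℝ} (ht : 0 ≤ t) :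
    Summable fun n => termBound C a n t := by
  have hlim : Tendsto (fun n => C * timeMoment a n * t ^ (1 - a)) atTop (𝓝 0) := by
    simpa using ((tendsto_timeMoment ha1).const_mul C).mul_const (t ^ (1 - a))
  refine summable_of_ratio_norm_eventually_le (r := 1 / 2) (by norm_num) ?_
  filter_upwards [hlim.eventually_le_const (show (0 : ℝ) < 1 / 2 by norm_num)] with n hn
  rw [Real.norm_of_nonneg (termBound_nonneg hC _ ht),
    Real.norm_of_nonneg (termBound_nonneg hC _ ht)]
  have e : termBound C a (n + 1) t = C * timeMoment a n * t ^ (1 - a) * termBound C a n t := by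
    rw [termBound, termBound, seriesCoeff, show ((n + 1 : ℕ) : ℝ) * (1 - a) =
      (1 - a) + n * (1 - a) by push_cast; ring, Real.rpow_add_of_nonneg ht (by linarith)
      (mul_nonneg n.cast_nonneg (by linarith))]
    ring
  rw [e]
  exact mul_le_mul_of_nonneg_right hn (termBound_nonneg hC _ ht)

/-- The recursion for `seriesCoeff` is chosen to make this an equality, so that the induction on the
terms of the series closes. -/
lemma lintegral_termBound_mul {C a : ℝ} (hC : 0 ≤ C) (ha1 : a < 1) (n : ℕ) {t : ℝ}
    (ht : 0 < t) :
    ∫⁻ s in Ioo 0 t, ENNReal.ofReal (termBound C a n s * (C * (s ^ (-a) + (t - s) ^ (-a)))) =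
      ENNReal.ofReal (termBound C a (n + 1) t) := by
  have e : (fun s => termBound C a n s * (C * (s ^ (-a) + (t - s) ^ (-a)))) =
      fun s => seriesCoeff C a n * C * (s ^ (n * (1 - a)) * (s ^ (-a) + (t - s) ^ (-a))) := by
    ext s; rw [termBound]; ring
  have hi := (intervalIntegrable_rpow_mul_rpow_neg_add ha1 n t).const_mul (seriesCoeff C a n * C)
  rw [intervalIntegrable_iff_integrableOn_Ioo_of_le ht.le] at hi
  rw [← ofReal_integral_eq_lintegral_ofReal]
  · rw [e, integral_const_mul, ← integral_Ioc_eq_integral_Ioo,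
      ← intervalIntegral.integral_of_le ht.le, integral_rpow_mul_rpow_neg_add n ht, termBound,
      seriesCoeff]
    congr 1; ring
  · rw [e]; exact hi
  · refine (ae_restrict_mem measurableSet_Ioo).mono fun s hs => ?_
    have h0 := hs.1.le
    have h1 := sub_nonneg.2 hs.2.le
    have := termBound_nonneg (a := a) hC n h0
    simp only [Pi.zero_apply]
    positivity

/-! ### Joint measurability and the basic time-space estimate. -/

lemma measurable_perturbTerm {d : ℕ} {V : Rd d → ℝ} (hV : Measurable V) (n : ℕ) :
    Measurable fun w : ℝ × Rd d × Rd d => perturbTerm V n w.1 w.2.1 w.2.2 := by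
  induction n with
  | zero => exact measurable_gaussKernel
  | succ n ih =>
    have h1 : Measurable fun q : ((ℝ × Rd d × Rd d) × ℝ) × Rd d =>
        perturbTerm V n q.1.2 q.1.1.2.1 q.2 * V q.2 *
          gaussKernel (q.1.1.1 - q.1.2) q.2 q.1.1.2.2 := by
      refine ((ih.comp (f := fun q : ((ℝ × Rd d × Rd d) × ℝ) × Rd d =>
        (q.1.2, q.1.1.2.1, q.2)) (by fun_prop)).mul (hV.comp measurable_snd)).mul
        (measurable_gaussKernel.comp (f := fun q : ((ℝ × Rd d × Rd d) × ℝ) × Rd d =>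
          (q.1.1.1 - q.1.2, q.2, q.1.1.2.2)) (by fun_prop))
    have h2 := h1.stronglyMeasurable.integral_prod_right' (ν := volume)
    -- The domain (0,t) depends on the parameter t, so it is encoded as an indicator before
    -- integrating.
    have hS : MeasurableSet {q : (ℝ × Rd d × Rd d) × ℝ | q.2 ∈ Ioo 0 q.1.1} :=
      (measurableSet_lt measurable_const measurable_snd).inter
        (measurableSet_lt measurable_snd (by fun_prop))
    have h3 := (h2.indicator hS).integral_prod_right' (ν := volume)
    convert h3.measurable using 1
    ext w
    simp only [perturbTerm]
    rw [← integral_indicator measurableSet_Ioo]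
    rfl

lemma measurable_schrodingerKernel {d : ℕ} {V : Rd d → ℝ} (hV : Measurable V) :
    Measurable fun w : ℝ × Rd d × Rd d => schrodingerKernel V w.1 w.2.1 w.2.2 :=
  Measurable.tsum fun n => measurable_perturbTerm hV n

lemma Measurable.duhamelIntegrand {d : ℕ} {V : Rd d → ℝ} (hV : Measurable V)
    {F : ℝ → Rd d → Rd d → ℝ} (hF : Measurable fun w : ℝ × Rd d × Rd d => F w.1 w.2.1 w.2.2)
    (t : ℝ) (x y : Rd d) :
    Measurable fun w : ℝ × Rd d => F w.1 x w.2 * V w.2 * gaussKernel (t - w.1) w.2 y :=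
  ((hF.comp (f := fun w : ℝ × Rd d => (w.1, x, w.2)) (by fun_prop)).mul
    (hV.comp measurable_snd)).mul
    (measurable_gaussKernel.comp (f := fun w : ℝ × Rd d => (t - w.1, w.2, y)) (by fun_prop))

lemma lintegral_Ioo_prod_univ {d : ℕ} {t : ℝ} {f : ℝ × Rd d → ℝ≥0∞} (hf : Measurable f) :
    ∫⁻ w in Ioo 0 t ×ˢ univ, f w = ∫⁻ s in Ioo 0 t, ∫⁻ z, f (s, z) := by
  rw [Measure.volume_eq_prod, ← Measure.prod_restrict, Measure.restrict_univ,
    lintegral_prod _ hf.aemeasurable]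

/-- Potentials with an integrable singularity in the bridge bound. -/
structure IsSubcritical {d : ℕ} (V : Rd d → ℝ) (C a : ℝ) : Prop where
  measurable : Measurable V
  nonneg : 0 ≤ C
  lt_one : a < 1
  bound : BridgeBound V C a

/-- The set I of times and the weight β are left free for two uses: the full interval with β =
`termBound`, and a middle window with β = 1. -/
lemma BridgeBound.lintegral_le {d : ℕ} {V : Rd d → ℝ} {C a : ℝ} (h : BridgeBound V C a)
    {F : ℝ → Rd d → ℝ} {β : ℝ → ℝ} {I : Set ℝ} (hI : MeasurableSet I) {t : ℝ}
    (hIt : I ⊆ Ioo 0 t) {x : Rd d} (y : Rd d) (hβ : ∀ s ∈ I, 0 ≤ β s)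
    (hF : ∀ s ∈ I, ∀ z, |F s z| ≤ β s * gaussKernel s x z) :
    ∫⁻ s in I, ∫⁻ z, ‖F s z * V z * gaussKernel (t - s) z y‖ₑ ≤
      (∫⁻ s in I, ENNReal.ofReal (β s * (C * (s ^ (-a) + (t - s) ^ (-a))))) *
        ENNReal.ofReal (gaussKernel t x y) := by
  rw [← lintegral_mul_const' _ _ ENNReal.ofReal_ne_top]
  refine setLIntegral_mono' hI fun s hs => ?_
  have hs0 := (hIt hs).1
  have hs1 : 0 < t - s := sub_pos.2 (hIt hs).2
  calc ∫⁻ z, ‖F s z * V z * gaussKernel (t - s) z y‖ₑ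
      ≤ ∫⁻ z, ENNReal.ofReal (β s) * (ENNReal.ofReal (gaussKernel s x z) * ‖V z‖ₑ *
          ENNReal.ofReal (gaussKernel (t - s) z y)) := by
        refine lintegral_mono fun z => ?_
        rw [enorm_mul, enorm_mul, ← mul_assoc, ← mul_assoc, ← ENNReal.ofReal_mul (hβ s hs)]
        rw [Real.enorm_of_nonneg (gaussKernel_pos hs1 z y).le]
        gcongr
        rw [Real.enorm_eq_ofReal_abs]
        exact ENNReal.ofReal_le_ofReal (hF s hs z)
    _ ≤ ENNReal.ofReal (β s) * (ENNReal.ofReal (C * (s ^ (-a) + (t - s) ^ (-a))) *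
          ENNReal.ofReal (gaussKernel t x y)) := by
        rw [lintegral_const_mul' _ _ ENNReal.ofReal_ne_top]
        gcongr
        have := h hs0 hs1 x y
        rwa [add_sub_cancel] at this
    _ = _ := by rw [ENNReal.ofReal_mul (hβ s hs), mul_assoc]

/-! ### Convergence of the series and Duhamel's formula. -/

section Subcritical

variable {d : ℕ} {V : Rd d → ℝ} {C a : ℝ}

lemma IsSubcritical.lintegral_le (h : IsSubcritical V C a) (n : ℕ) {F : ℝ → Rd d → ℝ} {t : ℝ}
    (ht : 0 < t) {x : Rd d} (y : Rd d)
    (hF : ∀ s ∈ Ioo 0 t, ∀ z, |F s z| ≤ termBound C a n s * gaussKernel s x z) :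
    ∫⁻ s in Ioo 0 t, ∫⁻ z, ‖F s z * V z * gaussKernel (t - s) z y‖ₑ ≤
      ENNReal.ofReal (termBound C a (n + 1) t * gaussKernel t x y) := by
  refine (h.bound.lintegral_le measurableSet_Ioo subset_rfl y
    (fun s hs => termBound_nonneg h.nonneg n hs.1.le) hF).trans_eq ?_
  rw [lintegral_termBound_mul h.nonneg h.lt_one n ht,
    ENNReal.ofReal_mul (termBound_nonneg h.nonneg _ ht.le)]

lemma IsSubcritical.abs_perturbTerm_le (h : IsSubcritical V C a) (n : ℕ) {t : ℝ} (ht : 0 < t)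
    (x y : Rd d) : |perturbTerm V n t x y| ≤ termBound C a n t * gaussKernel t x y := by
  induction n generalizing t y with
  | zero => simp [perturbTerm, abs_of_pos (gaussKernel_pos ht x y)]
  | succ n ih =>
    -- Working with lower Lebesgue integrals avoids assuming integrability, which is deduced from
    -- the same bound afterwards.
    rw [← ENNReal.ofReal_le_ofReal_iff (mul_nonneg (termBound_nonneg h.nonneg _ ht.le)
      (gaussKernel_pos ht x y).le), ← Real.enorm_eq_ofReal_abs]
    refine le_trans ?_ (h.lintegral_le n ht y fun s hs z => ih hs.1 z)
    rw [perturbTerm]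
    exact (enorm_integral_le_lintegral_enorm _).trans
      (lintegral_mono fun s => enorm_integral_le_lintegral_enorm _)

lemma IsSubcritical.lintegral_term_le (h : IsSubcritical V C a) (n : ℕ) {t : ℝ} (ht : 0 < t)
    (x y : Rd d) :
    ∫⁻ w in Ioo 0 t ×ˢ univ, ‖perturbTerm V n w.1 x w.2 * V w.2 * gaussKernel (t - w.1) w.2 y‖ₑ ≤
      ENNReal.ofReal (termBound C a (n + 1) t * gaussKernel t x y) := by
  rw [lintegral_Ioo_prod_univ
    (Measurable.duhamelIntegrand h.measurable (measurable_perturbTerm h.measurable n) t x y).enorm]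
  exact h.lintegral_le n ht y fun s hs z => h.abs_perturbTerm_le n hs.1 x z

lemma IsSubcritical.integrableOn_term (h : IsSubcritical V C a) (n : ℕ) {t : ℝ} (ht : 0 < t)
    (x y : Rd d) :
    IntegrableOn
      (fun w : ℝ × Rd d => perturbTerm V n w.1 x w.2 * V w.2 * gaussKernel (t - w.1) w.2 y)
      (Ioo 0 t ×ˢ univ) volume :=
  ⟨(Measurable.duhamelIntegrand h.measurable
    (measurable_perturbTerm h.measurable n) t x y).aestronglyMeasurable,
    (h.lintegral_term_le n ht x y).trans_lt ENNReal.ofReal_lt_top⟩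

lemma IsSubcritical.summable_abs (h : IsSubcritical V C a) {t : ℝ} (ht : 0 < t) (x y : Rd d) :
    Summable fun n => |perturbTerm V n t x y| :=
  Summable.of_nonneg_of_le (fun _ => abs_nonneg _) (fun n => h.abs_perturbTerm_le n ht x y)
    ((summable_termBound h.nonneg h.lt_one ht.le).mul_right _)

/-- The relative bound for the perturbation series. -/
def seriesBound (C a t : ℝ) : ℝ := ∑' n, termBound C a n t

lemma seriesBound_mono (hC : 0 ≤ C) (ha1 : a < 1) {s t : ℝ} (hs : 0 ≤ s) (hst : s ≤ t) :
    seriesBound C a s ≤ seriesBound C a t :=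
  (summable_termBound hC ha1 hs).tsum_le_tsum (fun n => termBound_mono hC ha1 n hs hst)
    (summable_termBound hC ha1 (hs.trans hst))

lemma IsSubcritical.tsum_abs_le (h : IsSubcritical V C a) {t : ℝ} (ht : 0 < t) (x y : Rd d) :
    ∑' n, |perturbTerm V n t x y| ≤ seriesBound C a t * gaussKernel t x y := by
  rw [seriesBound, ← tsum_mul_right]
  exact (h.summable_abs ht x y).tsum_le_tsum (fun n => h.abs_perturbTerm_le n ht x y)
    ((summable_termBound h.nonneg h.lt_one ht.le).mul_right _)

lemma IsSubcritical.abs_schrodingerKernel_le (h : IsSubcritical V C a) {t : ℝ} (ht : 0 < t)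
    (x y : Rd d) : |schrodingerKernel V t x y| ≤ seriesBound C a t * gaussKernel t x y :=
  (norm_tsum_le_tsum_norm (f := fun n => perturbTerm V n t x y)
    (h.summable_abs ht x y)).trans (h.tsum_abs_le ht x y)

lemma IsSubcritical.integrableOn_duhamel (h : IsSubcritical V C a) {t : ℝ} (ht : 0 < t)
    (x y : Rd d) :
    IntegrableOn
      (fun w : ℝ × Rd d => schrodingerKernel V w.1 x w.2 * V w.2 * gaussKernel (t - w.1) w.2 y)
      (Ioo 0 t ×ˢ univ) volume := by
  -- On (0,t) the kernel G is at most `seriesBound C a t` times g, so the integrand of p₁ serves as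
  -- majorant.
  refine Integrable.mono' ((h.integrableOn_term 0 ht x y).norm.const_mul (seriesBound C a t))
    (Measurable.duhamelIntegrand h.measurable
      (measurable_schrodingerKernel h.measurable) t x y).aestronglyMeasurable ?_
  refine (ae_restrict_mem (measurableSet_Ioo.prod MeasurableSet.univ)).mono fun w hw => ?_
  have hs := hw.1
  simp only [perturbTerm, norm_mul, Real.norm_eq_abs]
  rw [← mul_assoc, ← mul_assoc]
  gcongr
  rw [abs_of_pos (gaussKernel_pos hs.1 _ _)]
  refine (h.abs_schrodingerKernel_le hs.1 _ _).trans ?_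
  gcongr
  · exact (gaussKernel_pos hs.1 _ _).le
  · exact seriesBound_mono h.nonneg h.lt_one hs.1.le hs.2.le

lemma IsSubcritical.perturbTerm_succ (h : IsSubcritical V C a) (n : ℕ) {t : ℝ} (ht : 0 < t)
    (x y : Rd d) :
    perturbTerm V (n + 1) t x y = ∫ w in Ioo 0 t ×ˢ univ,
      perturbTerm V n w.1 x w.2 * V w.2 * gaussKernel (t - w.1) w.2 y := by
  have := setIntegral_prod _ (h.integrableOn_term n ht x y)
  rw [Measure.volume_eq_prod, this, perturbTerm]
  simp only [Measure.restrict_univ]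

lemma IsSubcritical.duhamel (h : IsSubcritical V C a) {t : ℝ} (ht : 0 < t) (x y : Rd d) :
    schrodingerKernel V t x y = gaussKernel t x y + ∫ w in Ioo 0 t ×ˢ univ,
      schrodingerKernel V w.1 x w.2 * V w.2 * gaussKernel (t - w.1) w.2 y := by
  have hs := (h.summable_abs ht x y).of_abs
  rw [schrodingerKernel, hs.tsum_eq_zero_add]
  congr 1
  have hg := gaussKernel_pos ht x y
  have hsum : Summable fun n => ∫ w in Ioo 0 t ×ˢ univ,
      ‖perturbTerm V n w.1 x w.2 * V w.2 * gaussKernel (t - w.1) w.2 y‖ := by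
    refine Summable.of_nonneg_of_le (fun n => integral_nonneg fun _ => norm_nonneg _)
      (fun n => ?_) (((summable_nat_add_iff 1).2
        (summable_termBound h.nonneg h.lt_one ht.le)).mul_right (gaussKernel t x y))
    rw [integral_norm_eq_lintegral_enorm (h.integrableOn_term n ht x y).1]
    exact ENNReal.toReal_le_of_le_ofReal
      (mul_nonneg (termBound_nonneg h.nonneg _ ht.le) hg.le) (h.lintegral_term_le n ht x y)
  have := (hasSum_integral_of_summable_integral_norm
    (fun n => h.integrableOn_term n ht x y) hsum).tsum_eq
  simp_rw [h.perturbTerm_succ _ ht]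
  rw [this]
  simp_rw [schrodingerKernel, ← tsum_mul_right]

theorem IsSubcritical.perturbationWellDefined (h : IsSubcritical V C a) :
    PerturbationWellDefined V where
  term_integrable n _ x y ht := h.integrableOn_term n ht x y
  series_summable _ x y ht := (h.summable_abs ht x y).of_abs
  duhamel_integrable _ x y ht := h.integrableOn_duhamel ht x y
  duhamel t x y ht := by
    have := setIntegral_prod _ (h.integrableOn_duhamel ht x y)
    rw [h.duhamel ht, Measure.volume_eq_prod, this]
    simp only [Measure.restrict_univ]

end Subcritical

/-! ### Splitting time-space integrals at an intermediate time. -/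

section TimeShift

variable {d : ℕ}

lemma measurePreserving_timeShift (s : ℝ) :
    MeasurePreserving
      ((MeasurableEquiv.addLeft s).prodCongr (MeasurableEquiv.refl (Rd d))) :=
  (measurePreserving_add_left volume s).prod (MeasurePreserving.id volume)

lemma timeShift_preimage (s t : ℝ) :
    ((MeasurableEquiv.addLeft s).prodCongr (MeasurableEquiv.refl (Rd d))) ⁻¹'
      (Ioo s (s + t) ×ˢ univ) = Ioo 0 t ×ˢ univ := by
  ext w
  change (s + w.1 ∈ Ioo s (s + t) ∧ _) ↔ _
  simp

lemma integrableOn_timeShift {s t : ℝ} {f : ℝ × Rd d → ℝ}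
    (hf : IntegrableOn f (Ioo s (s + t) ×ˢ univ) volume) :
    IntegrableOn (fun w : ℝ × Rd d => f (s + w.1, w.2)) (Ioo 0 t ×ˢ univ) volume := by
  rw [← timeShift_preimage s t]
  exact ((measurePreserving_timeShift s).integrableOn_comp_preimage
    (MeasurableEquiv.measurableEmbedding _)).2 hf

lemma setIntegral_timeShift (s t : ℝ) (f : ℝ × Rd d → ℝ) :
    ∫ w in Ioo s (s + t) ×ˢ univ, f w = ∫ w in Ioo 0 t ×ˢ univ, f (s + w.1, w.2) := by
  rw [← timeShift_preimage s t]
  exact ((measurePreserving_timeShift s).setIntegral_preimage_emb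
    (MeasurableEquiv.measurableEmbedding _) f _).symm

lemma setIntegral_Ioo_split {s t : ℝ} (hs : 0 < s) (ht : 0 < t) {f : ℝ × Rd d → ℝ}
    (hf : IntegrableOn f (Ioo 0 (s + t) ×ˢ univ) volume) :
    ∫ w in Ioo 0 (s + t) ×ˢ univ, f w =
      (∫ w in Ioo 0 s ×ˢ univ, f w) + ∫ w in Ioo 0 t ×ˢ univ, f (s + w.1, w.2) := by
  have hu : Ioo 0 (s + t) ×ˢ (univ : Set (Rd d)) =
      Ioc 0 s ×ˢ univ ∪ Ioo s (s + t) ×ˢ univ := by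
    rw [← union_prod, Ioc_union_Ioo_eq_Ioo hs.le (by linarith)]
  have hae : (Ioo 0 s ×ˢ (univ : Set (Rd d)) : Set (ℝ × Rd d)) =ᵐ[volume] Ioc 0 s ×ˢ univ :=
    Measure.set_prod_ae_eq Ioo_ae_eq_Ioc (ae_eq_refl _)
  rw [hu] at hf ⊢
  rw [setIntegral_union _ (measurableSet_Ioo.prod MeasurableSet.univ)
    (hf.mono_set subset_union_left) (hf.mono_set subset_union_right),
    setIntegral_congr_set hae.symm, setIntegral_timeShift]
  exact Disjoint.set_prod_left (Set.disjoint_left.2 fun u h1 h2 => not_lt.2 h1.2 h2.1) _ _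

end TimeShift

/-! ### Chapman–Kolmogorov equations. -/

section ChapmanKolmogorov

variable {d : ℕ} {V : Rd d → ℝ} {C a : ℝ}

/-- Fubini, followed by Chapman–Kolmogorov for g after the last interaction. The lower limit r is 0
for the series and positive for `middleTerm`. -/
lemma IsSubcritical.integral_Ioo_mul_gaussKernel (h : IsSubcritical V C a) (n : ℕ) {r s t : ℝ}
    (hr : 0 ≤ r) (hs : 0 < s) (ht : 0 < t) (x y : Rd d) :
    Integrable (fun w => (∫ q in Ioo r s ×ˢ univ,
      perturbTerm V n q.1 x q.2 * V q.2 * gaussKernel (s - q.1) q.2 w) * gaussKernel t w y) ∧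
    ∫ w, (∫ q in Ioo r s ×ˢ univ,
        perturbTerm V n q.1 x q.2 * V q.2 * gaussKernel (s - q.1) q.2 w) * gaussKernel t w y =
      ∫ q in Ioo r s ×ˢ univ,
        perturbTerm V n q.1 x q.2 * V q.2 * gaussKernel (s + t - q.1) q.2 y := by
  have hmS : MeasurableSet (Ioo r s ×ˢ (univ : Set (Rd d))) :=
    measurableSet_Ioo.prod MeasurableSet.univ
  set μ : Measure (ℝ × Rd d) := volume.restrict (Ioo r s ×ˢ univ) with hμ
  let f : ℝ × Rd d → Rd d → ℝ := fun q w => perturbTerm V n q.1 x q.2 * V q.2 *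
    (gaussKernel (s - q.1) q.2 w * gaussKernel t w y)
  have hpos : ∀ᵐ q ∂μ, 0 < s - q.1 :=
    (ae_restrict_mem hmS).mono fun q hq => sub_pos.2 hq.1.2
  have hadd (q : ℝ × Rd d) : s - q.1 + t = s + t - q.1 := by ring
  have hI : IntegrableOn
      (fun q : ℝ × Rd d => perturbTerm V n q.1 x q.2 * V q.2 * gaussKernel (s + t - q.1) q.2 y)
      (Ioo r s ×ˢ univ) volume :=
    (h.integrableOn_term n (add_pos hs ht) x y).mono_set
      (prod_mono (Ioo_subset_Ioo hr (by linarith)) subset_rfl)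
  have hfm : Measurable (Function.uncurry f) := by
    refine (((measurable_perturbTerm h.measurable n).comp
      (f := fun q : (ℝ × Rd d) × Rd d => (q.1.1, x, q.1.2)) (by fun_prop)).mul
      (h.measurable.comp (f := fun q : (ℝ × Rd d) × Rd d => q.1.2) (by fun_prop))).mul
      ((measurable_gaussKernel.comp
        (f := fun q : (ℝ × Rd d) × Rd d => (s - q.1.1, q.1.2, q.2)) (by fun_prop)).mul
      (measurable_gaussKernel.comp
        (f := fun q : (ℝ × Rd d) × Rd d => (t, q.2, y)) (by fun_prop)))
  have hfi : Integrable (Function.uncurry f) (μ.prod volume) := by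
    rw [integrable_prod_iff hfm.aestronglyMeasurable]
    refine ⟨hpos.mono fun q hq => (integrable_gaussKernel_mul hq ht q.2 y).const_mul
      (perturbTerm V n q.1 x q.2 * V q.2),
      hI.norm.congr (hpos.mono fun q hq => ?_)⟩
    simp only [Function.uncurry, f, norm_mul, integral_const_mul]
    congr 1
    simp_rw [Real.norm_eq_abs, fun z w => abs_of_pos (gaussKernel_pos hq z w),
      fun z w => abs_of_pos (gaussKernel_pos ht z w)]
    rw [integral_gaussKernel_mul hq ht, hadd,
      abs_of_pos (gaussKernel_pos (by rw [← hadd]; positivity) _ _)]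
  have e : (fun w => (∫ q in Ioo r s ×ˢ univ,
      perturbTerm V n q.1 x q.2 * V q.2 * gaussKernel (s - q.1) q.2 w) * gaussKernel t w y) =
      fun w => ∫ q, f q w ∂μ := by
    ext w
    rw [← integral_mul_const]
    simp only [f, hμ, mul_assoc]
  rw [e]
  refine ⟨hfi.integral_prod_right, ?_⟩
  rw [← integral_integral_swap hfi]
  refine integral_congr_ae (hpos.mono fun q hq => ?_)
  simp only [f, integral_const_mul]
  rw [integral_gaussKernel_mul hq ht, hadd]

lemma IsSubcritical.integral_mul_gaussKernel (h : IsSubcritical V C a) (n : ℕ) {s t : ℝ}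
    (hs : 0 < s) (ht : 0 < t) (x y : Rd d) :
    ∫ q in Ioo 0 s ×ˢ univ,
        perturbTerm V n q.1 x q.2 * V q.2 * gaussKernel (s + t - q.1) q.2 y =
      ∫ w, perturbTerm V (n + 1) s x w * gaussKernel t w y := by
  rw [← (h.integral_Ioo_mul_gaussKernel n le_rfl hs ht x y).2]
  simp_rw [h.perturbTerm_succ n hs]

/-- This licenses Fubini when a factor is prepended. The bounds by `termBound` reduce it to k = l =
0, where Chapman–Kolmogorov for g applies. -/
lemma IsSubcritical.integrable_prod (h : IsSubcritical V C a) (k l : ℕ) {s t : ℝ}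
    (hs : 0 < s) (ht : 0 < t) (x y : Rd d) :
    Integrable (fun q : (ℝ × Rd d) × Rd d => perturbTerm V k s x q.2 *
        (perturbTerm V l q.1.1 q.2 q.1.2 * V q.1.2 * gaussKernel (t - q.1.1) q.1.2 y))
      ((volume.restrict (Ioo 0 t ×ˢ univ)).prod volume) := by
  have hmS : MeasurableSet (Ioo 0 t ×ˢ (univ : Set (Rd d))) :=
    measurableSet_Ioo.prod MeasurableSet.univ
  set μ : Measure (ℝ × Rd d) := volume.restrict (Ioo 0 t ×ˢ univ) with hμ
  have hmem : ∀ᵐ q ∂μ, q.1 ∈ Ioo 0 t := (ae_restrict_mem hmS).mono fun q hq => hq.1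
  have hV : Measurable fun q : (ℝ × Rd d) × Rd d => V q.1.2 :=
    h.measurable.comp (by fun_prop)
  have hg1 : Measurable fun q : (ℝ × Rd d) × Rd d => gaussKernel (t - q.1.1) q.1.2 y :=
    measurable_gaussKernel.comp
      (f := fun q : (ℝ × Rd d) × Rd d => (t - q.1.1, q.1.2, y)) (by fun_prop)
  have hp (k l : ℕ) : Measurable fun q : (ℝ × Rd d) × Rd d => perturbTerm V k s x q.2 *
      (perturbTerm V l q.1.1 q.2 q.1.2 * V q.1.2 * gaussKernel (t - q.1.1) q.1.2 y) :=
    ((measurable_perturbTerm h.measurable k).comp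
      (f := fun q : (ℝ × Rd d) × Rd d => (s, x, q.2)) (by fun_prop)).mul
      ((((measurable_perturbTerm h.measurable l).comp
      (f := fun q : (ℝ × Rd d) × Rd d => (q.1.1, q.2, q.1.2)) (by fun_prop)).mul hV).mul hg1)
  have hI := integrableOn_timeShift ((h.integrableOn_term 0 (add_pos hs ht) x y).mono_set
    (prod_mono (Ioo_subset_Ioo_left hs.le) subset_rfl))
  have h0 : Integrable (fun q : (ℝ × Rd d) × Rd d => perturbTerm V 0 s x q.2 *
      (perturbTerm V 0 q.1.1 q.2 q.1.2 * V q.1.2 * gaussKernel (t - q.1.1) q.1.2 y))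
      (μ.prod volume) := by
    rw [integrable_prod_iff (hp 0 0).aestronglyMeasurable]
    simp only [perturbTerm]
    refine ⟨hmem.mono fun q hq => ?_, hI.norm.congr (hmem.mono fun q hq => ?_)⟩
    · simp_rw [mul_assoc, ← mul_assoc (gaussKernel s x _)]
      exact (integrable_gaussKernel_mul hs hq.1 x q.2).mul_const _
    · simp only [perturbTerm, norm_mul, ← mul_assoc, integral_mul_const]
      simp_rw [Real.norm_eq_abs, fun z w => abs_of_pos (gaussKernel_pos hq.1 z w),
        fun z w => abs_of_pos (gaussKernel_pos hs z w)]
      rw [integral_gaussKernel_mul hs hq.1, add_sub_add_left_eq_sub,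
        abs_of_pos (gaussKernel_pos (add_pos hs hq.1) _ _)]
  refine (h0.norm.const_mul (termBound C a k s * termBound C a l t)).mono'
    (hp k l).aestronglyMeasurable ?_
  have hmem' : ∀ᵐ q ∂(μ.prod (volume : Measure (Rd d))), q.1.1 ∈ Ioo 0 t :=
    Measure.quasiMeasurePreserving_fst.ae hmem
  filter_upwards [hmem'] with q hq
  have hA := h.abs_perturbTerm_le k hs x q.2
  have hB : |perturbTerm V l q.1.1 q.2 q.1.2| ≤
      termBound C a l t * gaussKernel q.1.1 q.2 q.1.2 :=
    (h.abs_perturbTerm_le l hq.1 q.2 q.1.2).trans (mul_le_mul_of_nonneg_right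
      (termBound_mono h.nonneg h.lt_one l hq.1.le hq.2.le) (gaussKernel_pos hq.1 _ _).le)
  simp only [norm_mul, Real.norm_eq_abs, perturbTerm]
  rw [abs_of_pos (gaussKernel_pos hs x q.2), abs_of_pos (gaussKernel_pos hq.1 q.2 q.1.2)]
  calc _ ≤ termBound C a k s * gaussKernel s x q.2 *
        (termBound C a l t * gaussKernel q.1.1 q.2 q.1.2 * |V q.1.2| *
          |gaussKernel (t - q.1.1) q.1.2 y|) := by
        gcongr
        exact (abs_nonneg _).trans hA
    _ = _ := by ring

lemma IsSubcritical.integral_integral_mul (h : IsSubcritical V C a) (k l : ℕ) {s t : ℝ}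
    (hs : 0 < s) (ht : 0 < t) (x y : Rd d) :
    ∫ q in Ioo 0 t ×ˢ univ, (∫ w, perturbTerm V k s x w * perturbTerm V l q.1 w q.2) * V q.2 *
        gaussKernel (t - q.1) q.2 y =
      ∫ w, perturbTerm V k s x w * perturbTerm V (l + 1) t w y := by
  have hsw := integral_integral_swap (f := fun (q : ℝ × Rd d) w => perturbTerm V k s x w *
    (perturbTerm V l q.1 w q.2 * V q.2 * gaussKernel (t - q.1) q.2 y))
    (h.integrable_prod k l hs ht x y)
  calc _ = _ := by
        refine integral_congr_ae (.of_forall fun q => ?_)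
        simp only [← integral_mul_const, mul_assoc]
    _ = _ := hsw
    _ = _ := by
        congr 1
        ext w
        rw [h.perturbTerm_succ l ht, integral_const_mul]

lemma IsSubcritical.integrableOn_integral_mul (h : IsSubcritical V C a) (k l : ℕ) {s t : ℝ}
    (hs : 0 < s) (ht : 0 < t) (x y : Rd d) :
    IntegrableOn (fun q : ℝ × Rd d => (∫ w, perturbTerm V k s x w * perturbTerm V l q.1 w q.2) *
      V q.2 * gaussKernel (t - q.1) q.2 y) (Ioo 0 t ×ˢ univ) volume := by
  refine (h.integrable_prod k l hs ht x y).integral_prod_left.congr (.of_forall fun q => ?_)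
  simp only [← integral_mul_const, mul_assoc]

/-- The Chapman–Kolmogorov equations for the terms of the perturbation series. -/
lemma IsSubcritical.perturbTerm_add (h : IsSubcritical V C a) (n : ℕ) {s t : ℝ}
    (hs : 0 < s) (ht : 0 < t) (x y : Rd d) :
    perturbTerm V n (s + t) x y = ∑ kl ∈ Finset.HasAntidiagonal.antidiagonal n,
      ∫ w, perturbTerm V kl.1 s x w * perturbTerm V kl.2 t w y := by
  induction n generalizing t y with
  | zero => simpa [perturbTerm] using (integral_gaussKernel_mul hs ht x y).symm
  | succ n ih =>
    -- Split by the time of the last interaction. If it precedes s, the rest is free and gives the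
    -- summand with second index 0; if it follows s, the induction hypothesis gives all the others.
    rw [h.perturbTerm_succ n (add_pos hs ht), setIntegral_Ioo_split hs ht
      (h.integrableOn_term n (add_pos hs ht) x y), h.integral_mul_gaussKernel n hs ht,
      Finset.Nat.sum_antidiagonal_succ']
    congr 1
    rw [Finset.sum_congr rfl fun kl _ => (h.integral_integral_mul kl.1 kl.2 hs ht x y).symm,
      ← integral_finsetSum]
    swap
    · exact fun kl _ => h.integrableOn_integral_mul kl.1 kl.2 hs ht x y
    refine setIntegral_congr_fun (measurableSet_Ioo.prod MeasurableSet.univ) fun q hq => ?_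
    simp only [add_sub_add_left_eq_sub]
    rw [ih hq.1.1, Finset.sum_mul, Finset.sum_mul]

lemma IsSubcritical.integrable_schrodingerKernel_mul (h : IsSubcritical V C a) {s t : ℝ}
    (hs : 0 < s) (ht : 0 < t) (x y : Rd d) :
    Integrable fun z => schrodingerKernel V s x z * schrodingerKernel V t z y := by
  refine ((integrable_gaussKernel_mul hs ht x y).const_mul
    (seriesBound C a s * seriesBound C a t)).mono' ?_ (.of_forall fun z => ?_)
  · exact (((measurable_schrodingerKernel h.measurable).comp
      (f := fun z : Rd d => (s, x, z)) (by fun_prop)).mul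
      ((measurable_schrodingerKernel h.measurable).comp
      (f := fun z : Rd d => (t, z, y)) (by fun_prop))).aestronglyMeasurable
  · rw [norm_mul, mul_mul_mul_comm]
    exact mul_le_mul (h.abs_schrodingerKernel_le hs x z) (h.abs_schrodingerKernel_le ht z y)
      (abs_nonneg _) ((abs_nonneg _).trans (h.abs_schrodingerKernel_le hs x z))

lemma IsSubcritical.integrable_perturbTerm_mul (h : IsSubcritical V C a) (k l : ℕ) {s t : ℝ}
    (hs : 0 < s) (ht : 0 < t) (x y : Rd d) :
    Integrable fun z => perturbTerm V k s x z * perturbTerm V l t z y := by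
  refine ((integrable_gaussKernel_mul hs ht x y).const_mul
    (termBound C a k s * termBound C a l t)).mono' ?_ (.of_forall fun z => ?_)
  · exact (((measurable_perturbTerm h.measurable k).comp
      (f := fun z : Rd d => (s, x, z)) (by fun_prop)).mul
      ((measurable_perturbTerm h.measurable l).comp
      (f := fun z : Rd d => (t, z, y)) (by fun_prop))).aestronglyMeasurable
  · rw [norm_mul, mul_mul_mul_comm]
    exact mul_le_mul (h.abs_perturbTerm_le k hs x z) (h.abs_perturbTerm_le l ht z y)
      (abs_nonneg _) ((abs_nonneg _).trans (h.abs_perturbTerm_le k hs x z))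

/-- The Chapman–Kolmogorov equations for the Schrödinger perturbation. -/
theorem IsSubcritical.integral_schrodingerKernel_mul (h : IsSubcritical V C a) {s t : ℝ}
    (hs : 0 < s) (ht : 0 < t) (x y : Rd d) :
    ∫ z, schrodingerKernel V s x z * schrodingerKernel V t z y =
      schrodingerKernel V (s + t) x y := by
  let T : ℕ → ℝ := fun n =>
    ∑ kl ∈ Finset.HasAntidiagonal.antidiagonal n, termBound C a kl.1 s * termBound C a kl.2 t
  have hT : Summable T := by
    refine (summable_norm_sum_mul_antidiagonal_of_summable_norm
      (summable_termBound h.nonneg h.lt_one hs.le).norm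
      (summable_termBound h.nonneg h.lt_one ht.le).norm).of_norm
  have key := hasSum_integral_of_dominated_convergence (μ := (volume : Measure (Rd d)))
    (F := fun n z => ∑ kl ∈ Finset.HasAntidiagonal.antidiagonal n,
      perturbTerm V kl.1 s x z * perturbTerm V kl.2 t z y)
    (f := fun z => schrodingerKernel V s x z * schrodingerKernel V t z y)
    (fun n z => T n * (gaussKernel s x z * gaussKernel t z y))
    (fun n => (integrable_finsetSum _ fun kl _ =>
      h.integrable_perturbTerm_mul kl.1 kl.2 hs ht x y).aestronglyMeasurable)
    (fun n => .of_forall fun z => ?_) (.of_forall fun z => hT.mul_right _) ?_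
    (.of_forall fun z => ?_)
  · rw [← key.tsum_eq, schrodingerKernel]
    refine tsum_congr fun n => ?_
    rw [h.perturbTerm_add n hs ht, integral_finsetSum _ fun kl _ =>
      h.integrable_perturbTerm_mul kl.1 kl.2 hs ht x y]
  · refine (norm_sum_le _ _).trans ?_
    rw [Finset.sum_mul]
    refine Finset.sum_le_sum fun kl _ => ?_
    rw [norm_mul, mul_mul_mul_comm]
    exact mul_le_mul (h.abs_perturbTerm_le _ hs x z) (h.abs_perturbTerm_le _ ht z y)
      (abs_nonneg _) ((abs_nonneg _).trans (h.abs_perturbTerm_le _ hs x z))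
  · simp_rw [tsum_mul_right]
    exact (integrable_gaussKernel_mul hs ht x y).const_mul _
  · have h1 : Summable fun n => ‖perturbTerm V n s x z‖ := h.summable_abs hs x z
    have h2 : Summable fun n => ‖perturbTerm V n t z y‖ := h.summable_abs ht z y
    simp only [schrodingerKernel]
    rw [tsum_mul_tsum_eq_tsum_sum_antidiagonal_of_summable_norm h1 h2]
    exact (summable_norm_sum_mul_antidiagonal_of_summable_norm h1 h2).of_norm.hasSum

end ChapmanKolmogorov

/-! ### Two-sided bounds on finite time intervals. -/

section LocalBounds

variable {d : ℕ} {V : Rd d → ℝ} {C a : ℝ}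

lemma IsSubcritical.exists_half_le (h : IsSubcritical V C a) :
    ∃ t₀, 0 < t₀ ∧ ∀ t, 0 < t → t ≤ t₀ → ∀ x y,
      1 / 2 * gaussKernel t x y ≤ schrodingerKernel V t x y := by
  have hδ : 0 < 1 - a := sub_pos.2 h.lt_one
  have hsum {t : ℝ} (ht : 0 ≤ t) : Summable fun n => termBound C a (n + 1) t :=
    (summable_nat_add_iff 1).2 (summable_termBound h.nonneg h.lt_one ht)
  set S : ℝ := ∑' n, termBound C a (n + 1) 1 with hS
  have hS0 : 0 ≤ S := tsum_nonneg fun n => termBound_nonneg h.nonneg _ zero_le_one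
  have hb : (0 : ℝ) < 1 / (2 * (S + 1)) := by positivity
  -- For t ≤ 1 every term past the zeroth carries a power of t at least 1-a, so the tail is at most
  -- t^{1-a} S; the second entry makes this at most 1/2.
  refine ⟨min 1 ((1 / (2 * (S + 1))) ^ (1 - a)⁻¹), by positivity, fun t ht htt x y => ?_⟩
  have ht1 : t ≤ 1 := htt.trans (min_le_left _ _)
  have htS : t ^ (1 - a) ≤ 1 / (2 * (S + 1)) := by
    refine (Real.rpow_le_rpow ht.le (htt.trans (min_le_right _ _)) hδ.le).trans_eq ?_
    rw [← Real.rpow_mul hb.le, inv_mul_cancel₀ hδ.ne', Real.rpow_one]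
  have hg := gaussKernel_pos ht x y
  have hle (n : ℕ) : termBound C a (n + 1) t ≤ t ^ (1 - a) * termBound C a (n + 1) 1 := by
    rw [termBound, termBound, Real.one_rpow, mul_one, mul_comm]
    refine mul_le_mul_of_nonneg_right ?_ (seriesCoeff_nonneg h.nonneg _)
    refine Real.rpow_le_rpow_of_exponent_ge ht ht1 ?_
    push_cast
    nlinarith [n.cast_nonneg (α := ℝ)]
  have h1 : ∑' n, termBound C a (n + 1) t ≤ 1 / 2 := by
    calc _ ≤ ∑' n, t ^ (1 - a) * termBound C a (n + 1) 1 :=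
          (hsum ht.le).tsum_le_tsum hle ((hsum zero_le_one).mul_left _)
      _ = t ^ (1 - a) * S := tsum_mul_left
      _ ≤ 1 / (2 * (S + 1)) * S := by gcongr
      _ ≤ 1 / 2 := by
          rw [div_mul_eq_mul_div, div_le_div_iff₀ (by positivity) two_pos]
          linarith
  have habs := (summable_nat_add_iff 1).2 (h.summable_abs ht x y)
  have h2 : |∑' n, perturbTerm V (n + 1) t x y| ≤ 1 / 2 * gaussKernel t x y := by
    calc _ ≤ ∑' n, |perturbTerm V (n + 1) t x y| :=
          norm_tsum_le_tsum_norm (f := fun n => perturbTerm V (n + 1) t x y) habs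
      _ ≤ ∑' n, termBound C a (n + 1) t * gaussKernel t x y :=
          habs.tsum_le_tsum (fun n => h.abs_perturbTerm_le _ ht x y) ((hsum ht.le).mul_right _)
      _ ≤ _ := by rw [tsum_mul_right]; gcongr
  rw [schrodingerKernel, (h.summable_abs ht x y).of_abs.tsum_eq_zero_add]
  change _ ≤ gaussKernel t x y + _
  linarith [neg_abs_le (∑' n, perturbTerm V (n + 1) t x y)]

/-- Compose two half-time bounds: both G and g satisfy Chapman–Kolmogorov, so doubling the horizon
squares the constant. -/
lemma IsSubcritical.sq_mul_le_of_mul_le (h : IsSubcritical V C a) {c t₀ : ℝ} (hc : 0 < c)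
    (hlow : ∀ t, 0 < t → t ≤ t₀ → ∀ x y, c * gaussKernel t x y ≤ schrodingerKernel V t x y)
    {t : ℝ} (ht : 0 < t) (htt : t ≤ 2 * t₀) (x y : Rd d) :
    c ^ 2 * gaussKernel t x y ≤ schrodingerKernel V t x y := by
  have ht2 : 0 < t / 2 := by positivity
  have hl := hlow (t / 2) ht2 (by linarith)
  have hg := fun x y : Rd d => (gaussKernel_pos ht2 x y).le
  calc c ^ 2 * gaussKernel t x y = c ^ 2 * gaussKernel (t / 2 + t / 2) x y := by rw [add_halves]
    _ = ∫ z, c ^ 2 * (gaussKernel (t / 2) x z * gaussKernel (t / 2) z y) := by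
        rw [integral_const_mul, integral_gaussKernel_mul ht2 ht2]
    _ ≤ ∫ z, schrodingerKernel V (t / 2) x z * schrodingerKernel V (t / 2) z y := by
        refine integral_mono ((integrable_gaussKernel_mul ht2 ht2 x y).const_mul _)
          (h.integrable_schrodingerKernel_mul ht2 ht2 x y) fun z => ?_
        calc _ = (c * gaussKernel (t / 2) x z) * (c * gaussKernel (t / 2) z y) := by ring
          _ ≤ _ := mul_le_mul (hl x z) (hl z y) (mul_nonneg hc.le (hg _ _))
            ((mul_nonneg hc.le (hg _ _)).trans (hl x z))
    _ = schrodingerKernel V t x y := by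
        rw [h.integral_schrodingerKernel_mul ht2 ht2, add_halves]

lemma IsSubcritical.exists_mul_le (h : IsSubcritical V C a) (T : ℝ) :
    ∃ c, 0 < c ∧ ∀ t, 0 < t → t ≤ T → ∀ x y,
      c * gaussKernel t x y ≤ schrodingerKernel V t x y := by
  obtain ⟨t₀, ht₀, hhalf⟩ := h.exists_half_le
  have key (N : ℕ) : ∃ c, 0 < c ∧ ∀ t, 0 < t → t ≤ 2 ^ N * t₀ → ∀ x y,
      c * gaussKernel t x y ≤ schrodingerKernel V t x y := by
    induction N with
    | zero => exact ⟨1 / 2, by norm_num, by simpa using hhalf⟩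
    | succ N ih =>
      obtain ⟨c, hc, hlow⟩ := ih
      refine ⟨c ^ 2, by positivity, fun t ht htt x y => ?_⟩
      exact h.sq_mul_le_of_mul_le hc hlow ht (htt.trans_eq (by ring)) x y
  obtain ⟨N, hN⟩ := pow_unbounded_of_one_lt (T / t₀) one_lt_two
  obtain ⟨c, hc, hlow⟩ := key N
  rw [div_lt_iff₀ ht₀] at hN
  exact ⟨c, hc, fun t ht htT => hlow t ht (htT.trans hN.le)⟩

theorem IsSubcritical.sharpLocalBounds (h : IsSubcritical V C a) {T : ℝ} (hT : 0 < T) :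
    SharpLocalBounds (schrodingerKernel V) T := by
  obtain ⟨c, hc, hlow⟩ := h.exists_mul_le T
  have hbd : ∀ (t : ℝ) (x y : Rd d), 0 < t → t ≤ T →
      c ≤ schrodingerKernel V t x y / gaussKernel t x y ∧
        schrodingerKernel V t x y / gaussKernel t x y ≤ seriesBound C a T := by
    intro t x y ht htT
    have hg := gaussKernel_pos ht x y
    refine ⟨(le_div_iff₀ hg).2 (hlow t ht htT x y), (div_le_iff₀ hg).2 ?_⟩
    exact ((le_abs_self _).trans (h.abs_schrodingerKernel_le ht x y)).trans
      (mul_le_mul_of_nonneg_right (seriesBound_mono h.nonneg h.lt_one ht.le htT) hg.le)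
  exact ⟨c, seriesBound C a T, hc, (hbd T 0 0 hT le_rfl).1.trans (hbd T 0 0 hT le_rfl).2, hbd⟩

/-- Positivity comes from the local lower bound with horizon t itself, whatever the sign of V. -/
lemma IsSubcritical.schrodingerKernel_pos (h : IsSubcritical V C a) {t : ℝ} (ht : 0 < t)
    (x y : Rd d) : 0 < schrodingerKernel V t x y := by
  obtain ⟨c, hc, hlow⟩ := h.exists_mul_le t
  exact (mul_pos hc (gaussKernel_pos ht x y)).trans_le (hlow t ht le_rfl x y)

end LocalBounds

/-! ### Bounds uniform in time for nonpositive potentials. -/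

section GlobalBounds

variable {d : ℕ} {V : Rd d → ℝ} {C a : ℝ}

lemma IsSubcritical.schrodingerKernel_le_gaussKernel (h : IsSubcritical V C a)
    (hV : ∀ x, V x ≤ 0) {t : ℝ} (ht : 0 < t) (x y : Rd d) :
    schrodingerKernel V t x y ≤ gaussKernel t x y := by
  rw [h.duhamel ht]
  refine add_le_of_nonpos_right (setIntegral_nonpos (measurableSet_Ioo.prod MeasurableSet.univ)
    fun w hw => ?_)
  exact mul_nonpos_of_nonpos_of_nonneg
    (mul_nonpos_of_nonneg_of_nonpos (h.schrodingerKernel_pos hw.1.1 _ _).le (hV _))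
    (gaussKernel_pos (sub_pos.2 hw.1.2) _ _).le

lemma IsSubcritical.gaussKernel_add_perturbTerm_one_le (h : IsSubcritical V C a)
    (hV : ∀ x, V x ≤ 0) {t : ℝ} (ht : 0 < t) (x y : Rd d) :
    gaussKernel t x y + perturbTerm V 1 t x y ≤ schrodingerKernel V t x y := by
  rw [h.duhamel ht, h.perturbTerm_succ 0 ht]
  refine add_le_add_right (setIntegral_mono_on (h.integrableOn_term 0 ht x y)
    (h.integrableOn_duhamel ht x y)
    (measurableSet_Ioo.prod MeasurableSet.univ) fun w hw => ?_) _
  exact mul_le_mul_of_nonneg_right (mul_le_mul_of_nonpos_right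
    (h.schrodingerKernel_le_gaussKernel hV hw.1.1 _ _) (hV _))
    (gaussKernel_pos (sub_pos.2 hw.1.2) _ _).le

/-- The part of the first term of the perturbation series with interaction times in `(r, s)`. -/
def middleTerm (V : Rd d → ℝ) (r s t : ℝ) (x y : Rd d) : ℝ :=
  ∫ q in Ioo r s ×ˢ univ, perturbTerm V 0 q.1 x q.2 * V q.2 * gaussKernel (t - q.1) q.2 y

/-- Free motion for time s before p₁ just delays the interaction times to (s, s+t). -/
lemma IsSubcritical.integral_gaussKernel_mul_perturbTerm_one (h : IsSubcritical V C a)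
    {s t : ℝ} (hs : 0 < s) (ht : 0 < t) (x y : Rd d) :
    ∫ z, gaussKernel s x z * perturbTerm V 1 t z y = middleTerm V s (s + t) (s + t) x y := by
  rw [middleTerm, setIntegral_timeShift]
  refine (h.integral_integral_mul 0 0 hs ht x y).symm.trans
    (setIntegral_congr_fun (measurableSet_Ioo.prod MeasurableSet.univ) fun q hq => ?_)
  simp only [perturbTerm, add_sub_add_left_eq_sub]
  rw [integral_gaussKernel_mul hs hq.1.1]

lemma IsSubcritical.mul_middleTerm_le (h : IsSubcritical V C a) (hV : ∀ x, V x ≤ 0)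
    {c A t : ℝ} (hA : 0 < A) (ht : 0 < t) (hc : 0 < c)
    (hlow : ∀ x y, c * gaussKernel A x y ≤ schrodingerKernel V A x y) (x y : Rd d) :
    c ^ 2 * (gaussKernel (A + t + A) x y + middleTerm V A (A + t) (A + t + A) x y) ≤
      schrodingerKernel V (A + t + A) x y := by
  have hAt := add_pos hA ht
  have hgA := fun x y : Rd d => (gaussKernel_pos hA x y).le
  have step (w : Rd d) :
      c * (gaussKernel (A + t) x w + middleTerm V A (A + t) (A + t) x w) ≤
        schrodingerKernel V (A + t) x w := by
    have i1 := integrable_gaussKernel_mul hA ht x w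
    have i2 : Integrable fun z => gaussKernel A x z * perturbTerm V 1 t z w :=
      h.integrable_perturbTerm_mul 0 1 hA ht x w
    rw [← h.integral_schrodingerKernel_mul hA ht, ← integral_gaussKernel_mul hA ht,
      ← h.integral_gaussKernel_mul_perturbTerm_one hA ht, ← integral_add i1 i2,
      ← integral_const_mul]
    refine integral_mono ((i1.add i2).const_mul c)
      (h.integrable_schrodingerKernel_mul hA ht x w) fun z => ?_
    -- The order matters: g + p₁ may be negative, so it is replaced by the positive G before cg is
    -- replaced by G.
    calc c * (gaussKernel A x z * gaussKernel t z w + gaussKernel A x z * perturbTerm V 1 t z w)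
        = c * gaussKernel A x z * (gaussKernel t z w + perturbTerm V 1 t z w) := by ring
      _ ≤ c * gaussKernel A x z * schrodingerKernel V t z w :=
          mul_le_mul_of_nonneg_left (h.gaussKernel_add_perturbTerm_one_le hV ht z w)
            (mul_nonneg hc.le (hgA x z))
      _ ≤ _ := mul_le_mul_of_nonneg_right (hlow x z) (h.schrodingerKernel_pos ht z w).le
  obtain ⟨i2, e2⟩ := h.integral_Ioo_mul_gaussKernel 0 hA.le hAt hA x y
  have i1 := integrable_gaussKernel_mul hAt hA x y
  rw [← h.integral_schrodingerKernel_mul hAt hA, ← integral_gaussKernel_mul hAt hA, middleTerm,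
    ← e2, ← integral_add i1 i2, ← integral_const_mul]
  refine integral_mono ((i1.add i2).const_mul _)
    (h.integrable_schrodingerKernel_mul hAt hA x y) fun w => ?_
  calc _ = c * (gaussKernel (A + t) x w + middleTerm V A (A + t) (A + t) x w) *
        (c * gaussKernel A w y) := by rw [middleTerm]; ring
    _ ≤ schrodingerKernel V (A + t) x w * (c * gaussKernel A w y) :=
        mul_le_mul_of_nonneg_right (step w) (mul_nonneg hc.le (hgA w y))
    _ ≤ _ := mul_le_mul_of_nonneg_left (hlow w y) (h.schrodingerKernel_pos hAt x w).le

/-- The reflection s ↦ 2A + t - s preserves (A, A+t), so both summands have the same integral, at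
most the integral of s^{-b} over (A,∞). The bound is therefore independent of t. -/
lemma lintegral_rpow_neg_add_le {C b A t : ℝ} (hC : 0 ≤ C) (hb : 1 < b) (hA : 0 < A)
    (ht : 0 < t) :
    ∫⁻ s in Ioo A (A + t), ENNReal.ofReal (C * (s ^ (-b) + (A + t + A - s) ^ (-b))) ≤
      ENNReal.ofReal (C * (2 * (A ^ (1 - b) / (b - 1)))) := by
  have hle : A ≤ A + t := by linarith
  have hi : IntervalIntegrable (fun s : ℝ => s ^ (-b)) volume A (A + t) :=
    intervalIntegral.intervalIntegrable_rpow (Or.inr fun h0 => by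
      rw [uIcc_of_le hle] at h0; linarith [h0.1])
  have hi' : IntervalIntegrable (fun s : ℝ => (A + t + A - s) ^ (-b)) volume A (A + t) := by
    have := (hi.comp_sub_left (A + t + A)).symm
    rwa [add_sub_cancel_left, add_sub_cancel_right] at this
  have hs := (hi.add hi').const_mul C
  rw [intervalIntegrable_iff_integrableOn_Ioo_of_le hle] at hs
  rw [← ofReal_integral_eq_lintegral_ofReal hs]
  · apply ENNReal.ofReal_le_ofReal
    rw [← integral_Ioc_eq_integral_Ioo, ← intervalIntegral.integral_of_le hle,
      intervalIntegral.integral_const_mul]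
    refine mul_le_mul_of_nonneg_left ?_ hC
    have h1 : ∫ s in A..(A + t), s ^ (-b) ≤ A ^ (1 - b) / (b - 1) := by
      rw [integral_rpow (Or.inr ⟨by linarith, fun h0 => by
        rw [uIcc_of_le hle] at h0; linarith [h0.1]⟩), neg_add_eq_sub, ← neg_div_neg_eq, neg_sub,
        neg_sub]
      exact div_le_div_of_nonneg_right (sub_le_self _ (by positivity)) (by linarith)
    have h2 : ∫ s in A..(A + t), (A + t + A - s) ^ (-b) = ∫ s in A..(A + t), s ^ (-b) := by
      rw [intervalIntegral.integral_comp_sub_left (fun s => s ^ (-b)), add_sub_cancel_left,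
        add_sub_cancel_right]
    rw [intervalIntegral.integral_add hi hi', h2]
    linarith
  · refine (ae_restrict_mem measurableSet_Ioo).mono fun s hs => ?_
    have h0 : 0 < s := hA.trans hs.1
    have h1 : 0 < A + t + A - s := by linarith [hs.2]
    simp only [Pi.zero_apply]
    positivity

lemma BridgeBound.abs_middleTerm_le (h : BridgeBound V C a) (hV : Measurable V) (hC : 0 ≤ C)
    (ha : 1 < a) {A t : ℝ} (hA : 0 < A) (ht : 0 < t) (x y : Rd d) :
    |middleTerm V A (A + t) (A + t + A) x y| ≤
      C * (2 * (A ^ (1 - a) / (a - 1))) * gaussKernel (A + t + A) x y := by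
  have hg := gaussKernel_pos (show 0 < A + t + A by positivity) x y
  have ha' : 0 < a - 1 := sub_pos.2 ha
  have hm := Measurable.duhamelIntegrand hV (measurable_perturbTerm hV 0) (A + t + A) x y
  rw [← ENNReal.ofReal_le_ofReal_iff (by positivity), ← Real.enorm_eq_ofReal_abs, middleTerm,
    ENNReal.ofReal_mul (by positivity)]
  refine (enorm_integral_le_lintegral_enorm _).trans ?_
  rw [Measure.volume_eq_prod, ← Measure.prod_restrict, Measure.restrict_univ,
    lintegral_prod _ hm.enorm.aemeasurable]
  have key := h.lintegral_le (F := fun s z => perturbTerm V 0 s x z) (β := fun _ => 1)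
    (I := Ioo A (A + t)) (t := A + t + A) measurableSet_Ioo
    (Ioo_subset_Ioo hA.le (by linarith)) (x := x) y (fun _ _ => zero_le_one)
    (fun s hs z => by
      rw [one_mul, perturbTerm, abs_of_pos (gaussKernel_pos (hA.trans hs.1) x z)])
  simp only [one_mul] at key
  exact key.trans (mul_le_mul_left (lintegral_rpow_neg_add_le hC ha hA ht) _)

theorem IsSubcritical.sharpGlobalBounds (h : IsSubcritical V C a) (hV : ∀ x, V x ≤ 0)
    {C' b : ℝ} (hb : 1 < b) (hC' : 0 < C') (hbound : BridgeBound V C' b) :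
    SharpGlobalBounds (schrodingerKernel V) := by
  have hlim : Tendsto (fun A : ℝ => C' * (2 * (A ^ (1 - b) / (b - 1)))) atTop (𝓝 0) := by
    have := ((tendsto_rpow_neg_atTop (sub_pos.2 hb)).div_const (b - 1)).const_mul 2
      |>.const_mul C'
    simpa [neg_sub] using this
  -- With this A the middle interactions remove at most half of g, which leaves the constant c²/2
  -- for times beyond 2A.
  obtain ⟨A, hA2, hA⟩ := ((hlim.eventually_le_const (show (0 : ℝ) < 1 / 2 by norm_num)).and
    (eventually_gt_atTop 0)).exists
  obtain ⟨c, hc, hlow⟩ := h.exists_mul_le (2 * A)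
  have hlower : ∀ (t : ℝ) (x y : Rd d), 0 < t →
      min c (c ^ 2 / 2) * gaussKernel t x y ≤ schrodingerKernel V t x y := by
    intro t x y ht
    have hg := gaussKernel_pos ht x y
    rcases le_or_gt t (2 * A) with htA | htA
    · exact (mul_le_mul_of_nonneg_right (min_le_left _ _) hg.le).trans (hlow t ht htA x y)
    · refine (mul_le_mul_of_nonneg_right (min_le_right _ _) hg.le).trans ?_
      obtain ⟨t', rfl⟩ : ∃ t', t = A + t' + A := ⟨t - 2 * A, by ring⟩
      have ht' : 0 < t' := by linarith
      refine le_trans ?_ (h.mul_middleTerm_le hV hA ht' hc (hlow A hA (by linarith)) x y)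
      have hm := hbound.abs_middleTerm_le h.measurable hC'.le hb hA ht' x y
      have hm' := hm.trans (mul_le_mul_of_nonneg_right hA2 hg.le)
      rw [div_eq_mul_one_div, mul_assoc]
      gcongr
      linarith [neg_abs_le (middleTerm V A (A + t') (A + t' + A) x y)]
  have hbd : ∀ (t : ℝ) (x y : Rd d), 0 < t →
      min c (c ^ 2 / 2) ≤ schrodingerKernel V t x y / gaussKernel t x y ∧
        schrodingerKernel V t x y / gaussKernel t x y ≤ 1 := by
    intro t x y ht
    have hg := gaussKernel_pos ht x y
    exact ⟨(le_div_iff₀ hg).2 (hlower t x y ht),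
      (div_le_one hg).2 (h.schrodingerKernel_le_gaussKernel hV ht x y)⟩
  exact ⟨_, 1, by positivity, (hbd 1 0 0 one_pos).1.trans (hbd 1 0 0 one_pos).2, hbd⟩

end GlobalBounds

/-! ### Arithmetic of the exponents. -/

section Exponents

lemma toReal_div_two_mul (d : ℕ) (p : ℝ≥0∞) :
    ((d : ℝ≥0∞) / (2 * p)).toReal = (d : ℝ) / 2 * (1 / p).toReal := by
  simp only [ENNReal.toReal_div, ENNReal.toReal_mul, ENNReal.toReal_natCast,
    ENNReal.toReal_ofNat, ENNReal.toReal_one]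
  rw [div_mul_div_comm, mul_one]

lemma exponent_sum_eq_one {d₁ d₂ : ℕ} {p₁ p₂ : ℝ≥0∞}
    (hp : (d₁ : ℝ≥0∞) / (2 * p₁) + (d₂ : ℝ≥0∞) / (2 * p₂) = 1) :
    (d₁ : ℝ) / 2 * (1 / p₁).toReal + (d₂ : ℝ) / 2 * (1 / p₂).toReal = 1 := by
  have h : (d₁ : ℝ≥0∞) / (2 * p₁) + (d₂ : ℝ≥0∞) / (2 * p₂) ≠ ∞ := hp ▸ ENNReal.one_ne_top
  rw [ENNReal.add_ne_top] at h
  rw [← toReal_div_two_mul, ← toReal_div_two_mul, ← ENNReal.toReal_add h.1 h.2, hp,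
    ENNReal.toReal_one]

/-- Strict monotonicity in the first exponent needs d₁ ≥ 1; it decides on which side of 1 the bridge
exponent lies. -/
lemma exponent_lt {d₁ : ℕ} (hd₁ : 1 ≤ d₁) (e : ℝ) {p r : ℝ≥0∞} (hp : 1 ≤ p) (hpr : p < r) :
    (d₁ : ℝ) / 2 * (1 / r).toReal + e < (d₁ : ℝ) / 2 * (1 / p).toReal + e := by
  have hd : (0 : ℝ) < d₁ := by exact_mod_cast hd₁
  have hp0 : p ≠ 0 := (zero_lt_one.trans_le hp).ne'
  gcongr
  · simpa using hp0
  · simp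

end Exponents

end GaussianBounds
end

theorem mainTheorem2 (d₁ d₂ : ℕ) (hd₁ : 1 ≤ d₁) (hd₂ : 1 ≤ d₂)
    (V : GaussianBounds.Rd (d₁ + d₂) → ℝ) (hV : Measurable V)
    (p₁ p₂ : ℝ≥0∞) (hp₁ : 1 ≤ p₁) (hp₂ : 1 ≤ p₂)
    (hp : (d₁ : ℝ≥0∞) / (2 * p₁) + (d₂ : ℝ≥0∞) / (2 * p₂) = 1) :
    (∀ r : ℝ≥0∞, p₁ < r →
      V ∈ GaussianBounds.tensorClass (GaussianBounds.LpFun d₁ r) (GaussianBounds.LpFun d₂ p₂) →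
      GaussianBounds.PerturbationWellDefined V ∧
        ∀ T : ℝ, 0 < T →
          GaussianBounds.SharpLocalBounds (GaussianBounds.schrodingerKernel V) T) ∧
    (∀ q r : ℝ≥0∞, 1 ≤ q → q < p₁ → p₁ < r →
      V ∈ GaussianBounds.tensorClass
        (GaussianBounds.LpFun d₁ q ∩ GaussianBounds.LpFun d₁ r) (GaussianBounds.LpFun d₂ p₂) →
      (∀ x, V x ≤ 0) →
      GaussianBounds.PerturbationWellDefined V ∧
        GaussianBounds.SharpGlobalBounds (GaussianBounds.schrodingerKernel V)) := by
  have hone := GaussianBounds.exponent_sum_eq_one hp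
  have sub (r : ℝ≥0∞) (hr : p₁ < r) (f₁ f₂) (hf₁ : MemLp f₁ r volume)
      (hf₂ : MemLp f₂ p₂ volume)
      (hf : ∀ x, V x = f₁ (GaussianBounds.fstPart x) * f₂ (GaussianBounds.sndPart x)) :
      ∃ C a, GaussianBounds.IsSubcritical V C a := by
    obtain ⟨C, hC, hb⟩ :=
      GaussianBounds.exists_bridgeBound_of_tensor (hp₁.trans hr.le) hp₂ hf₁ hf₂ hf
    exact ⟨C, _, hV, hC.le, (GaussianBounds.exponent_lt hd₁ _ hp₁ hr).trans_eq hone, hb⟩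
  refine ⟨?_, ?_⟩
  · rintro r hr ⟨f₁, hf₁, f₂, hf₂, hf⟩
    obtain ⟨C, a, h⟩ := sub r hr f₁ f₂ hf₁ hf₂ hf
    exact ⟨h.perturbationWellDefined, fun T hT => h.sharpLocalBounds hT⟩
  · rintro q r hq hqp hr ⟨f₁, hf₁, f₂, hf₂, hf⟩ hVle
    obtain ⟨C, a, h⟩ := sub r hr f₁ f₂ hf₁.2 hf₂ hf
    -- The same V satisfies a second bridge bound, from V₁ ∈ L^q, whose exponent exceeds 1 and
    -- controls long times.
    obtain ⟨C', hC', hb⟩ := GaussianBounds.exists_bridgeBound_of_tensor hq hp₂ hf₁.1 hf₂ hf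
    exact ⟨h.perturbationWellDefined, h.sharpGlobalBounds hVle
      (hone.symm.trans_lt (GaussianBounds.exponent_lt hd₁ _ hq hqp)) hC' hb⟩
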